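/- A planar convex body is a compact convex subset of $\mathbb{E}^2$ with non-empty interior. For a planar convex body $K$ let $g_K(x)=V(K\cap(K+x))$ ($x\in\mathbb{E}^2$, $V$ = area) be its covariogram and $DK=\{x-y : x,y\in K\}$ its difference body. For planar convex bodies $K,H$ and a closed set $X\subseteq\mathbb{E}^2$, let $\mathbf{GC}(X)$ denote the condition that $g_K(x)=g_H(x)$ for all $x$ in some neighbourhood of $X$. A reflection always means a reflection in a point. A pair of closed boundary arcs of $K$ is called a local symmetry of $K$ if the two arcs are reflections of each other, have disjoint and non-empty relative interiors (in $\operatorname{bd} K$), and are not properly contained in a pair of closed boundary arcs with the same properties. **Theorem 1.3.** Let $K$ and $H$ be planar convex bodies with $K$ strictly convex. Then the following statements hold true. - (I) If $K$ is $o$-symmetric (that is, $K=-K$) and $A$ is a closed simple curve in $\operatorname{int} DK$ bounding an open connected region in $DK$ that contains the origin $o$, then the conditions $DK=DH$ and $\mathbf{GC}(A)$ imply that $H$ is a translate or a reflection of $K$. - (II) If $X$ is either $\{o\}$ or $\operatorname{bd} DK$, then $\mathbf{GC}(X)$ implies that all local symmetries of $K$ and $H$ coincide up to translations: for every local symmetry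 $\{A^+,A^-\}$ of $K$ there is a vector $v$ such that $\{A^++v,A^-+v\}$ is a local symmetry of $H$, and the same holds with the roles of $K$ and $H$ interchanged. -/

import Mathlib

open scoped Topology Pointwise

namespace PlanarCovariogram

/-- The Euclidean plane; `volume` on it is the area. -/
abbrev Plane : Type := EuclideanSpace ℝ (Fin 2)

/-- The covariogram `g_K(x) = V(K ∩ (K + x))`. -/
noncomputable def covariogram (K : Set Plane) (x : Plane) : ℝ :=
  (MeasureTheory.volume (K ∩ (x +ᵥ K))).toReal

/-- The difference body `DK = {x - y | x, y ∈ K}`. -/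
def diffBody (K : Set Plane) : Set Plane := K - K

/-- Covariogram coincidence on `X`: `g_K = g_H` on some neighbourhood of the set `X`. -/
def CovariogramCoincidence (K H X : Set Plane) : Prop :=
  ∀ᶠ x in 𝓝ˢ X, covariogram K x = covariogram H x

/-- `K` and `H` coincide up to translations and reflections in a point. -/
def CoincideUpToTranslationReflection (K H : Set Plane) : Prop :=
  (∃ v : Plane, H = v +ᵥ K) ∨ (∃ c : Plane, H = Equiv.pointReflection c '' K)

/-- `A` is a closed simple curve: the image of a circle under a continuous injective map. -/
def IsClosedSimpleCurve (A : Set Plane) : Prop :=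
  ∃ γ : Circle → Plane, Continuous γ ∧ Function.Injective γ ∧ Set.range γ = A

/-- `A` bounds an open region (open connected set) in `D` that contains the origin. -/
def BoundsRegionAroundOrigin (A D : Set Plane) : Prop :=
  ∃ U : Set Plane, IsOpen U ∧ IsConnected U ∧ frontier U = A ∧ U ⊆ D ∧ (0 : Plane) ∈ U

/-- Closed arcs of the boundary of `K`: closed connected nonempty subsets of `bd K`. As `bd K` is a
simple closed curve for a planar convex body `K`, these are the closed arcs in the usual sense
(homeomorphic to `[0,1]`), the single points and the whole curve `bd K`; the latter two never occur
in a symmetric pair of arcs (defined below), by its conditions on relative interiors. -/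
def IsClosedBoundaryArc (K A : Set Plane) : Prop :=
  A ⊆ frontier K ∧ IsClosed A ∧ IsConnected A

/-- The relative interior of a boundary arc `A` of `K`, that is, its interior in the space `bd K`
(for an arc homeomorphic to `[0,1]`: the arc without its endpoints; for a point: empty). -/
def arcRelInterior (K A : Set Plane) : Set Plane := {p | p ∈ A ∧ A ∈ 𝓝[frontier K] p}

/-- `A` and `B` are closed boundary arcs of `K` that are reflections of each other in a point
and have disjoint and nonempty relative interiors. -/
structure IsSymmetricArcPair (K A B : Set Plane) : Prop where
  arc_left : IsClosedBoundaryArc K A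
  arc_right : IsClosedBoundaryArc K B
  reflection : ∃ c : Plane, B = Equiv.pointReflection c '' A
  nonempty_left : (arcRelInterior K A).Nonempty
  nonempty_right : (arcRelInterior K B).Nonempty
  disjoint : Disjoint (arcRelInterior K A) (arcRelInterior K B)

/-- The pair `A`, `B` is a local symmetry of `K`: a symmetric pair of arcs which is not properly
contained in another one. (`IsSymmetricArcPair` is symmetric in `A` and `B`, so the pairs are in
effect unordered.) -/
def IsLocalSymmetry (K A B : Set Plane) : Prop :=
  IsSymmetricArcPair K A B ∧
    ∀ A' B' : Set Plane, IsSymmetricArcPair K A' B' → A ⊆ A' → B ⊆ B' → A' = A ∧ B' = B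

/-- The local symmetries of `K` and `H` coincide up to translations: every local symmetry of one
body is carried by some translation (which may depend on the local symmetry) to a local symmetry
of the other. -/
def LocalSymmetriesCoincide (K H : Set Plane) : Prop :=
  (∀ A B : Set Plane, IsLocalSymmetry K A B → ∃ v : Plane, IsLocalSymmetry H (v +ᵥ A) (v +ᵥ B)) ∧
  (∀ A B : Set Plane, IsLocalSymmetry H A B → ∃ v : Plane, IsLocalSymmetry K (v +ᵥ A) (v +ᵥ B))

end PlanarCovariogram

namespace PlanarCovariogram

open MeasureTheory Set Filter

/-! ### The cross product in the plane -/

/-! The proof reads inscribed parallelograms off the covariogram. For a strictly convex body and `x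
≠ 0` interior to the difference body, exactly one inscribed parallelogram has `x` as a side; let `d`
be its other side. Above the line through one side parallel to `d` the body lies in its translate by
`x`, and below it the translate lies in the body. Hence `g(x)` is a sum of two cap areas. The same
sum with that line fixed and `x` varied bounds `g` from above and is differentiable at `x` with
gradient `d` up to a quarter turn. Knowing `g` near `x` should therefore give `d`. Differentiability
of `g` is not needed: adding a steep paraboloid produces local minima arbitrarily close to `x`,
where the upper bounds for both bodies are stationary, so both have the same `d`. A compactness
argument moves this back to `x` itself (`Inscribed.transfer`).

A boundary point `k` of the difference body belongs to a unique chord, a translate of `[0, k]`, with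
a centre. If the chords of `k` and `k'` in `K` share their centre, they are the diagonals of a
parallelogram with sides `(k ± k')/2`; coincidence of covariograms near `(k + k')/2` then forces a
common centre in `H` too (`IsCenter.transfer`). `H` is strictly convex because its difference body
is that of `K`.

For (I), all centres of `K` are at the origin. For each `k₀` some midpoint `(k₀ + k')/2` lies on the
curve; `k'` then ties the centre in `H` of `k₀` to those of its neighbours. So the centre in `H` is
locally constant, hence constant by connectedness, and `H` is a translate
(`exists_vadd_eq_of_symmetric`).

For (II), coincidence near the origin determines all widths, and coincidence near the boundary of
`DK` determines the support of `g`, so the difference bodies agree. Taking `k` near `±k₀` shows that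
wherever centres stay constant in one body they do so in the other. A symmetric pair of arcs is a
connected family of chords with one centre, so it reappears in `H` translated; passing back from `H`
to `K` gives maximality (`IsLocalSymmetry.exists_vadd`). -/

/-- The cross product (signed area) of two plane vectors. -/
def cross (x y : Plane) : ℝ := x 0 * y 1 - x 1 * y 0

lemma cross_add_left (x y z : Plane) : cross (x + y) z = cross x z + cross y z := by
  simp [cross]; ring

lemma cross_add_right (x y z : Plane) : cross x (y + z) = cross x y + cross x z := by
  simp [cross]; ring

lemma cross_sub_left (x y z : Plane) : cross (x - y) z = cross x z - cross y z := by
  simp [cross]; ring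

lemma cross_sub_right (x y z : Plane) : cross x (y - z) = cross x y - cross x z := by
  simp [cross]; ring

lemma cross_smul_left (a : ℝ) (x y : Plane) : cross (a • x) y = a * cross x y := by
  simp [cross]; ring

lemma cross_smul_right (a : ℝ) (x y : Plane) : cross x (a • y) = a * cross x y := by
  simp [cross]; ring

lemma cross_neg_left (x y : Plane) : cross (-x) y = -cross x y := by
  simp [cross]; ring

lemma cross_neg_right (x y : Plane) : cross x (-y) = -cross x y := by
  simp [cross]; ring

@[simp] lemma cross_self (x : Plane) : cross x x = 0 := by
  simp [cross]; ring

@[simp] lemma cross_zero_left (x : Plane) : cross 0 x = 0 := by simp [cross]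

@[simp] lemma cross_zero_right (x : Plane) : cross x 0 = 0 := by simp [cross]

lemma cross_swap (x y : Plane) : cross x y = -cross y x := by
  simp [cross]; ring

@[fun_prop]
lemma Continuous.cross {α : Type*} [TopologicalSpace α] {f g : α → Plane} (hf : Continuous f)
    (hg : Continuous g) : Continuous fun a => cross (f a) (g a) := by
  unfold PlanarCovariogram.cross
  fun_prop

/-- The linear functional `cross d`. -/
noncomputable def crossL (d : Plane) : Plane →L[ℝ] ℝ :=
  d 0 • EuclideanSpace.proj 1 - d 1 • EuclideanSpace.proj 0

@[simp] lemma crossL_apply (d y : Plane) : crossL d y = cross d y := by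
  simp [crossL, cross]

lemma cross_decomp {d x : Plane} (h : cross d x ≠ 0) (y : Plane) :
    y = (cross y x / cross d x) • d + (cross d y / cross d x) • x := by
  ext i
  fin_cases i <;> simp <;> field_simp <;> simp [cross] <;> ring

/-- The rotation by a right angle. -/
noncomputable def rot (x : Plane) : Plane := !₂[-x 1, x 0]

lemma cross_rot_right (x : Plane) : cross x (rot x) = ‖x‖ ^ 2 := by
  simp [cross, rot, EuclideanSpace.norm_sq_eq]; ring

lemma cross_rot_left (x : Plane) : cross (rot x) x = -‖x‖ ^ 2 := by
  rw [cross_swap, cross_rot_right]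

lemma exists_smul_of_cross_eq_zero {x y : Plane} (hx : x ≠ 0) (h : cross x y = 0) :
    ∃ t : ℝ, y = t • x := by
  have hr : cross x (rot x) ≠ 0 := by
    rw [cross_rot_right]; positivity
  have := cross_decomp hr y
  rw [h] at this
  exact ⟨_, by simpa using this⟩

lemma eq_of_cross_eq {d e : Plane} (h : ∀ u, cross d u = cross e u) : d = e := by
  by_contra hne
  have h1 := h (rot (d - e))
  have h2 : cross (d - e) (rot (d - e)) = 0 := by rw [cross_sub_left, h1, sub_self]
  rw [cross_rot_right] at h2
  have : 0 < ‖d - e‖ ^ 2 := by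
    have : d - e ≠ 0 := sub_ne_zero.2 hne
    positivity
  linarith

lemma exists_cross_eq (f : Plane →L[ℝ] ℝ) : ∃ e : Plane, ∀ y, f y = cross e y := by
  refine ⟨!₂[f (EuclideanSpace.single 1 1), -f (EuclideanSpace.single 0 1)], fun y => ?_⟩
  have hy : y = y 0 • EuclideanSpace.single 0 1 + y 1 • EuclideanSpace.single 1 1 := by
    ext i; fin_cases i <;> simp
  conv_lhs => rw [hy]
  simp [cross]; ring

/-! ### Strictly convex bodies and inscribed parallelograms -/

/-- Compact strictly convex sets with interior points. -/
structure StrictBody (K : Set Plane) : Prop where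
  compact : IsCompact K
  strict : StrictConvex ℝ K
  interior_nonempty : (interior K).Nonempty

lemma StrictBody.convex {K : Set Plane} (hK : StrictBody K) : Convex ℝ K := hK.strict.convex

lemma StrictBody.closed {K : Set Plane} (hK : StrictBody K) : IsClosed K := hK.compact.isClosed

lemma StrictBody.mem_of_frontier {K : Set Plane} (hK : StrictBody K) {p : Plane}
    (hp : p ∈ frontier K) : p ∈ K := hK.closed.frontier_subset hp

lemma StrictBody.mem_frontier {K : Set Plane} (hK : StrictBody K) {p : Plane} :
    p ∈ frontier K ↔ p ∈ K ∧ p ∉ interior K := by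
  rw [hK.closed.frontier_eq]; rfl

/-- A point beyond a side of an inscribed parallelogram would make a vertex an interior point. -/
lemma not_mem_beyond_vertex {K : Set Plane} (hK : StrictConvex ℝ K) {p q x y : Plane}
    (hp : p ∉ interior K) (hq : q ∈ K) (hpx : p - x ∈ K) (hc : cross (p - q) x ≠ 0)
    {l t : ℝ} (hl : 0 < l) (ht : 0 ≤ t) (hy : y = p + l • (p - q) + t • x) : y ∉ K := by
  intro hyK
  have hyq : y ≠ q := by
    rintro rfl
    have h0 : (1 + l) • (p - y) + t • x = 0 := by
      have : (1 + l) • (p - y) + t • x = p + l • (p - y) + t • x - y := by module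
      rw [this, ← hy, sub_self]
    have h1 : cross ((1 + l) • (p - y) + t • x) x = 0 := by rw [h0]; simp
    rw [cross_add_left, cross_smul_left, cross_smul_left, cross_self] at h1
    have : (1 + l) * cross (p - y) x = 0 := by linarith
    rcases mul_eq_zero.1 this with h2 | h2
    · linarith
    · exact hc h2
  have h1l : 0 < 1 + l := by positivity
  -- `r` is where the segment from `y` to `q` crosses the line through `p` in direction `x`. It is
  -- interior, and `p` lies between `r` and `p - x` (or is `r`).
  set r := p + (t / (1 + l)) • x with hr
  have hrint : r ∈ interior K := by
    have := hK hyK hq hyq (a := 1 / (1 + l)) (b := l / (1 + l)) (by positivity) (by positivity)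
      (by field_simp)
    convert this using 1
    rw [hr, hy]
    match_scalars <;> field_simp <;> ring
  apply hp
  set s := t / (1 + l) with hs
  have hs0 : 0 ≤ s := by positivity
  have := hK.convex.combo_interior_self_mem_interior hrint hpx (a := 1 / (1 + s))
    (b := s / (1 + s)) (by positivity) (by positivity) (by field_simp)
  convert this using 1
  rw [hr]
  match_scalars <;> field_simp <;> ring

/-- `p`, `p - d`, `p - x`, `p - d - x` are the vertices of a parallelogram inscribed in `K`. -/
structure Inscribed (K : Set Plane) (p d x : Plane) : Prop where
  pos : 0 < cross d x
  mem₁ : p ∈ frontier K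
  mem₂ : p - d ∈ frontier K
  mem₃ : p - x ∈ frontier K
  mem₄ : p - d - x ∈ frontier K

/-- Rotating the parallelogram by a half turn. -/
lemma Inscribed.flip {K : Set Plane} {p d x : Plane} (h : Inscribed K p d x) :
    Inscribed K (p - d - x) (-d) (-x) where
  pos := by rw [cross_neg_left, cross_neg_right, neg_neg]; exact h.pos
  mem₁ := h.mem₄
  mem₂ := by convert h.mem₃ using 1; abel
  mem₃ := by convert h.mem₂ using 1; abel
  mem₄ := by convert h.mem₁ using 1; abel

/-- Outside the strip swept by the parallelogram in direction `x`, the point would lie beyond a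
vertex, which `not_mem_beyond_vertex` excludes. -/
lemma Inscribed.range_of_above {K : Set Plane} (hK : StrictBody K) {p d x : Plane}
    (h : Inscribed K p d x) {y : Plane} (hy : y ∈ K) (hyp : 0 ≤ cross d (y - p)) :
    0 ≤ cross (y - (p - d)) x ∧ cross (y - (p - d)) x ≤ cross d x := by
  have hd := h.pos
  have hdec := cross_decomp hd.ne' (y - (p - d))
  have hτ : cross d (y - (p - d)) = cross d (y - p) := by
    have : y - (p - d) = (y - p) + d := by abel
    rw [this, cross_add_right]; simp
  have hτ0 : 0 ≤ cross d (y - p) / cross d x := by positivity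
  rw [hτ] at hdec
  constructor
  · by_contra! hlt
    refine not_mem_beyond_vertex hK.strict (hK.mem_frontier.1 h.mem₂).2
      (hK.mem_of_frontier h.mem₁) (hK.mem_of_frontier h.mem₄) ?_
      (l := -(cross (y - (p - d)) x / cross d x)) ?_ hτ0 ?_ hy
    · have : p - d - p = -d := by abel
      rw [this, cross_neg_left]; simpa using hd.ne'
    · rw [neg_pos]; exact div_neg_of_neg_of_pos hlt hd
    · have : p - d - p = -d := by abel
      rw [this, smul_neg, neg_smul, neg_neg, add_assoc, ← hdec]; abel
  · by_contra! hlt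
    refine not_mem_beyond_vertex hK.strict (hK.mem_frontier.1 h.mem₁).2
      (hK.mem_of_frontier h.mem₂) (hK.mem_of_frontier h.mem₃) ?_
      (l := cross (y - (p - d)) x / cross d x - 1) ?_ hτ0 ?_ hy
    · have : p - (p - d) = d := by abel
      rw [this]; exact hd.ne'
    · rw [sub_pos, lt_div_iff₀ hd]; linarith
    · have : p - (p - d) = d := by abel
      rw [this, sub_smul, one_smul]
      have h3 : p + ((cross (y - (p - d)) x / cross d x) • d - d) +
          (cross d (y - p) / cross d x) • x = p - d + ((cross (y - (p - d)) x / cross d x) • d +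
          (cross d (y - p) / cross d x) • x) := by abel
      rw [h3, ← hdec]; abel

/-- Project `y` along `x` to a point `r` of the side `[p - d, p]`. The body contains `r - x`, `r`
and `y`, and `y - x` lies between the first and the last. So above this side the body is contained
in its translate by `x`. -/
lemma Inscribed.sub_mem {K : Set Plane} (hK : StrictBody K) {p d x : Plane}
    (h : Inscribed K p d x) {y : Plane} (hy : y ∈ K) (hyp : 0 ≤ cross d (y - p)) : y - x ∈ K := by
  have hd := h.pos
  obtain ⟨h1, h2⟩ := h.range_of_above hK hy hyp
  have hdec := cross_decomp hd.ne' (y - (p - d))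
  have hτ : cross d (y - (p - d)) = cross d (y - p) := by
    have : y - (p - d) = (y - p) + d := by abel
    rw [this, cross_add_right]; simp
  rw [hτ] at hdec
  set α := cross (y - (p - d)) x / cross d x with hα
  set τ := cross d (y - p) / cross d x with hτ'
  have hτ0 : 0 ≤ τ := by positivity
  have hα0 : 0 ≤ α := by positivity
  have hα1 : α ≤ 1 := by rw [hα, div_le_one hd]; exact h2
  have hr : p - d + α • d ∈ K := by
    have := hK.convex (hK.mem_of_frontier h.mem₁) (hK.mem_of_frontier h.mem₂) hα0
      (sub_nonneg.2 hα1) (by ring)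
    convert this using 1; module
  have hrx : p - d + α • d - x ∈ K := by
    have := hK.convex (hK.mem_of_frontier h.mem₃) (hK.mem_of_frontier h.mem₄) hα0
      (sub_nonneg.2 hα1) (by ring)
    convert this using 1; module
  have hye : y = p - d + α • d + τ • x := by
    rw [add_assoc, ← hdec]; abel
  rcases le_total τ 1 with hle | hle
  · have := hK.convex hr hrx hτ0 (sub_nonneg.2 hle) (by ring)
    convert this using 1; rw [hye]; module
  · have hτp : 0 < τ := by linarith
    have := hK.convex hr hy (a := 1 / τ) (b := 1 - 1 / τ) (by positivity)
      (by rw [sub_nonneg, div_le_one hτp]; exact hle) (by ring)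
    convert this using 1; rw [hye]
    match_scalars <;> field_simp <;> ring

lemma Inscribed.mem_of_sub_mem {K : Set Plane} (hK : StrictBody K) {p d x : Plane}
    (h : Inscribed K p d x) {y : Plane} (hy : y - x ∈ K) (hyp : cross d (y - p) ≤ 0) : y ∈ K := by
  have := h.flip.sub_mem hK hy (by
    have : y - x - (p - d - x) = (y - p) + d := by abel
    rw [this, cross_neg_left, cross_add_right, cross_self]; linarith)
  simpa using this

lemma Inscribed.range {K : Set Plane} (hK : StrictBody K) {p d x : Plane}
    (h : Inscribed K p d x) {y : Plane} (hy : y ∈ K) (hyx : y - x ∈ K) :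
    0 ≤ cross (y - (p - d)) x ∧ cross (y - (p - d)) x ≤ cross d x := by
  rcases le_total 0 (cross d (y - p)) with hle | hle
  · exact h.range_of_above hK hy hle
  · have := h.flip.range_of_above hK hyx (by
      have : y - x - (p - d - x) = (y - p) + d := by abel
      rw [this, cross_neg_left, cross_add_right, cross_self]; linarith)
    have he : y - x - (p - d - x - -d) = y - (p - d) - d := by abel
    rw [he, cross_neg_right, cross_neg_left, cross_neg_right, cross_sub_left] at this
    constructor <;> linarith [this.1, this.2]

/-- Two chords of a strictly convex set on a line, translates of each other, coincide. -/
lemma eq_of_mem_frontier_of_cross_eq {K : Set Plane} (hK : StrictBody K) {p p' x : Plane}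
    (hx : x ≠ 0) (hp : p ∈ frontier K) (hpx : p - x ∈ frontier K) (hp' : p' ∈ frontier K)
    (hpx' : p' - x ∈ frontier K) (h : cross p x = cross p' x) : p = p' := by
  obtain ⟨t, ht⟩ := exists_smul_of_cross_eq_zero hx (y := p' - p)
    (by rw [cross_swap, cross_sub_left, h, sub_self, neg_zero])
  have key : ∀ a b : Plane, a ∈ frontier K → a - x ∈ frontier K → b ∈ frontier K → ∀ s : ℝ,
      b = a + s • x → ¬ 0 < s := by
    intro a b ha hax hb s hs hs0
    have hne : b ≠ a - x := by
      intro hba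
      have : (1 + s) • x = 0 := by
        have : (1 + s) • x = a + s • x - (a - x) := by module
        rw [this, ← hs, hba, sub_self]
      rcases smul_eq_zero.1 this with h0 | h0
      · linarith
      · exact hx h0
    have := hK.strict (hK.mem_of_frontier hb) (hK.mem_of_frontier hax) hne (a := 1 / (1 + s))
      (b := s / (1 + s)) (by positivity) (by positivity) (by field_simp)
    apply (hK.mem_frontier.1 ha).2
    convert this using 1
    rw [hs]
    match_scalars <;> field_simp <;> ring
  have h1 := key p p' hp hpx hp' t (by rw [← ht]; abel)
  have h2 := key p' p hp' hpx' hp (-t) (by rw [neg_smul, ← ht]; abel)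
  have : t = 0 := by linarith
  rw [this, zero_smul, sub_eq_zero] at ht
  exact ht.symm

/-- The strips in direction `x` spanned by the two parallelograms contain each other's sides, so
they are equal. On each bounding line strict convexity leaves one chord that is a translate of `x`.
-/
lemma Inscribed.unique {K : Set Plane} (hK : StrictBody K) {p d p' d' x : Plane}
    (h : Inscribed K p d x) (h' : Inscribed K p' d' x) : p = p' ∧ d = d' := by
  have hx : x ≠ 0 := by
    rintro rfl
    exact absurd h.pos (by simp)
  have m : ∀ {q}, q ∈ frontier K → q ∈ K := hK.mem_of_frontier
  have a1 := (h.range hK (m h'.mem₁) (m h'.mem₃)).2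
  have a2 := (h.range hK (m h'.mem₂) (m h'.mem₄)).1
  have b1 := (h'.range hK (m h.mem₁) (m h.mem₃)).2
  have b2 := (h'.range hK (m h.mem₂) (m h.mem₄)).1
  simp only [cross_sub_left] at a1 a2 b1 b2
  have e1 : p = p' := eq_of_mem_frontier_of_cross_eq hK hx h.mem₁ h.mem₃ h'.mem₁ h'.mem₃
    (by linarith)
  have e2 : p - d = p' - d' := eq_of_mem_frontier_of_cross_eq hK hx h.mem₂ h.mem₄ h'.mem₂ h'.mem₄
    (by simp only [cross_sub_left]; linarith)
  subst e1
  exact ⟨rfl, by simpa using e2⟩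

lemma exists_pos_add_smul_mem {K : Set Plane} {p : Plane} (hp : p ∈ interior K) (e : Plane) :
    ∃ ε : ℝ, 0 < ε ∧ p + ε • e ∈ K := by
  have hc : ContinuousAt (fun t : ℝ => p + t • e) 0 := by fun_prop
  have h1 : ∀ᶠ t in 𝓝 (0 : ℝ), p + t • e ∈ K :=
    hc (by simpa using mem_interior_iff_mem_nhds.1 hp)
  obtain ⟨ε, h1, h2⟩ := ((h1.filter_mono nhdsWithin_le_nhds).and
    (self_mem_nhdsWithin : Set.Ioi (0 : ℝ) ∈ 𝓝[>] 0)).exists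
  exact ⟨ε, h2, h1⟩

/-- If `p` were interior, `y = p + ε e` would be in `K`. Moving `p - x` a little towards `y`, and
`p` by the same vector, stays in `K` and increases `f`. -/
lemma not_interior_of_max {K : Set Plane} (hK : Convex ℝ K) {f : Plane →L[ℝ] ℝ} {x e p : Plane}
    (hfx : f x = 0) (hfe : 0 < f e) (hp : p ∈ K) (hpx : p - x ∈ K)
    (hmax : ∀ z, z ∈ K → z - x ∈ K → f z ≤ f p) : p ∉ interior K := by
  intro hint
  obtain ⟨ε, hε, hy⟩ := exists_pos_add_smul_mem hint e
  obtain ⟨t, ht, htK⟩ := exists_pos_add_smul_mem hint (p + ε • e - p + x)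
  set s := min t 1 with hs
  have hs0 : 0 < s := lt_min ht one_pos
  have hz : p + s • (p + ε • e - p + x) ∈ K := by
    have := hK hp htK (a := 1 - s / t) (b := s / t)
      (by rw [sub_nonneg, div_le_one ht]; exact min_le_left _ _) (by positivity) (by ring)
    convert this using 1
    match_scalars <;> field_simp <;> ring
  have hzx : p + s • (p + ε • e - p + x) - x ∈ K := by
    have := hK hpx hy (a := 1 - s) (b := s) (by rw [sub_nonneg]; exact min_le_right _ _) hs0.le
      (by ring)
    convert this using 1
    module
  have := hmax _ hz hzx
  simp [hfx] at this
  have : 0 < s * (ε * f e) := by positivity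
  linarith

/-- The points of `K ∩ (K + x)` extreme in the direction transversal to `x` give the two sides
parallel to `x`. The ball ensures that the two extremes differ. -/
lemma exists_inscribed {K : Set Plane} (hK : StrictBody K) {x z : Plane} (hx : x ≠ 0) {ρ : ℝ}
    (hρ : 0 < ρ) (h1 : Metric.closedBall z ρ ⊆ K) (h2 : ∀ y ∈ Metric.closedBall z ρ, y - x ∈ K) :
    ∃ p d, Inscribed K p d x := by
  set M := K ∩ {y | y - x ∈ K} with hM
  have hMc : IsCompact M := hK.compact.inter_right
    (hK.closed.preimage (by fun_prop : Continuous fun y : Plane => y - x))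
  have hsub : Metric.closedBall z ρ ⊆ M := fun y hy => ⟨h1 hy, h2 y hy⟩
  have hzM : z ∈ M := hsub (by simp [hρ.le])
  obtain ⟨p, hp, hpm⟩ := hMc.exists_isMaxOn ⟨z, hzM⟩
    (by fun_prop : Continuous fun y : Plane => cross y x).continuousOn
  obtain ⟨q, hq, hqm⟩ := hMc.exists_isMinOn ⟨z, hzM⟩
    (by fun_prop : Continuous fun y : Plane => cross y x).continuousOn
  have hmax : ∀ y ∈ M, cross y x ≤ cross p x := fun y hy => hpm hy
  have hmin : ∀ y ∈ M, cross q x ≤ cross y x := fun y hy => hqm hy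
  have hx2 : 0 < ‖x‖ ^ 2 := by positivity
  have hlt : cross q x < cross p x := by
    have hs : z - (ρ / ‖x‖) • rot x ∈ M := by
      apply hsub
      have hrn : ‖rot x‖ = ‖x‖ := by
        simp [rot, EuclideanSpace.norm_eq, add_comm]
      rw [Metric.mem_closedBall, dist_eq_norm]
      simp [norm_smul, hrn, abs_of_pos hρ]
      field_simp; exact le_rfl
    have a1 := hmax _ hs
    have a2 := hmin _ hzM
    rw [cross_sub_left, cross_smul_left, cross_rot_left] at a1
    have : 0 < ρ / ‖x‖ * ‖x‖ ^ 2 := by positivity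
    linarith
  have hfp : 0 < crossL x (rot x) := by rw [crossL_apply, cross_rot_right]; exact hx2
  have key : ∀ (f : Plane →L[ℝ] ℝ) (e p : Plane), f x = 0 → 0 < f e → p ∈ M →
      (∀ y ∈ M, f y ≤ f p) → p ∈ frontier K ∧ p - x ∈ frontier K := by
    intro f e p hfx hfe hp hmax
    constructor
    · refine hK.mem_frontier.2 ⟨hp.1, ?_⟩
      exact not_interior_of_max hK.convex hfx hfe hp.1 hp.2 fun z h1 h2 => hmax z ⟨h1, h2⟩
    · refine hK.mem_frontier.2 ⟨hp.2, ?_⟩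
      refine not_interior_of_max hK.convex (x := -x) (by simp [hfx]) hfe hp.2
        (by simpa using hp.1) fun z h1 h2 => ?_
      have := hmax (z + x) ⟨by simpa using h2, by simpa using h1⟩
      simpa [hfx] using this
  obtain ⟨p1, p2⟩ := key (-crossL x) (-rot x) p (by simp)
    (by simpa [cross_neg_right] using hfp) hp (fun y hy => by
    have := hmax y hy
    simp only [neg_apply, crossL_apply]
    rw [cross_swap x y, cross_swap x p]; linarith)
  obtain ⟨q1, q2⟩ := key (crossL x) (rot x) q (by simp) (by simpa using hfp) hq (fun y hy => by
    have := hmin y hy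
    simp only [crossL_apply]
    rw [cross_swap x y, cross_swap x q]; linarith)
  refine ⟨p, p - q, ?_, p1, by simpa using q1, p2, by simpa using q2⟩
  rw [cross_sub_left]; linarith

/-! ### Area and slices of a planar set by parallel lines -/

/-- The point with coordinates `(s, t)` on the line `cross d = s`, which has direction `d`. -/
noncomputable def framePt (d : Plane) (s t : ℝ) : Plane := (s / ‖d‖ ^ 2) • rot d + t • d

lemma cross_framePt {d : Plane} (hd : d ≠ 0) (s t : ℝ) : cross d (framePt d s t) = s := by
  have : ‖d‖ ≠ 0 := norm_ne_zero_iff.2 hd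
  rw [framePt, cross_add_right, cross_smul_right, cross_smul_right, cross_rot_right, cross_self]
  field_simp
  ring

lemma exists_framePt_eq {d : Plane} (hd : d ≠ 0) (y : Plane) :
    ∃ t, y = framePt d (cross d y) t := by
  have h : cross d (y - (cross d y / ‖d‖ ^ 2) • rot d) = 0 := by
    have : ‖d‖ ≠ 0 := norm_ne_zero_iff.2 hd
    rw [cross_sub_right, cross_smul_right, cross_rot_right]
    field_simp
    ring
  obtain ⟨t, ht⟩ := exists_smul_of_cross_eq_zero hd h
  exact ⟨t, by rw [framePt, ← ht]; abel⟩

lemma framePt_sub (d : Plane) (s t r : ℝ) : framePt d s t - r • d = framePt d s (t - r) := by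
  simp only [framePt]; module

lemma framePt_combo (d : Plane) {a b : ℝ} (s t s' t' : ℝ) :
    a • framePt d s t + b • framePt d s' t' = framePt d (a * s + b * s') (a * t + b * t') := by
  simp only [framePt]
  match_scalars <;> ring

@[fun_prop]
lemma continuous_framePt (d : Plane) : Continuous fun z : ℝ × ℝ => framePt d z.1 z.2 := by
  unfold framePt; fun_prop

/-- Coordinates with respect to the orthogonal frame generated by `d`. -/
noncomputable def frameCoords (d y : Plane) : ℝ × ℝ :=
  (cross d y, (d 0 * y 0 + d 1 * y 1) / ‖d‖ ^ 2)

lemma framePt_frameCoords {d : Plane} (hd : d ≠ 0) (y : Plane) :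
    framePt d (frameCoords d y).1 (frameCoords d y).2 = y := by
  have h2 : ‖d‖ ^ 2 ≠ 0 := by positivity
  have h3 : ‖d‖ ^ 2 = d 0 ^ 2 + d 1 ^ 2 := by simp [EuclideanSpace.norm_sq_eq]
  rw [h3] at h2
  ext i
  fin_cases i <;> simp [framePt, frameCoords, rot, cross, h3] <;> field_simp <;> ring

/-- The coordinate across the lines is stretched by `‖d‖` and the one along them shrunk by `‖d‖`, so
the determinant is `-1`. -/
lemma measurePreserving_frameCoords {d : Plane} (hd : d ≠ 0) :
    MeasurePreserving (frameCoords d) volume volume := by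
  have h2 : ‖d‖ ^ 2 ≠ 0 := by positivity
  have h3 : ‖d‖ ^ 2 = d 0 ^ 2 + d 1 ^ 2 := by simp [EuclideanSpace.norm_sq_eq]
  set M : Matrix (Fin 2) (Fin 2) ℝ := !![-d 1, d 0; d 0 / ‖d‖ ^ 2, d 1 / ‖d‖ ^ 2] with hM
  have hdet : M.det = -1 := by
    rw [hM, Matrix.det_fin_two_of]
    rw [h3] at h2 ⊢
    field_simp
    ring
  have hMp : MeasurePreserving (Matrix.toLin' M) volume volume := by
    refine ⟨(LinearMap.continuous_of_finiteDimensional _).measurable, ?_⟩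
    rw [Real.map_matrix_volume_pi_eq_smul_volume_pi (by rw [hdet]; norm_num), hdet]
    simp
  have hc := (volume_preserving_finTwoArrow ℝ).comp
    (hMp.comp (PiLp.volume_preserving_ofLp (Fin 2)))
  have he : frameCoords d = MeasurableEquiv.finTwoArrow ∘ Matrix.toLin' M ∘ WithLp.ofLp := by
    funext y
    refine Prod.ext ?_ ?_
    · simp [frameCoords, hM, cross, Matrix.mulVec, dotProduct, MeasurableEquiv.finTwoArrow]; ring
    · simp [frameCoords, hM, Matrix.mulVec, dotProduct, MeasurableEquiv.finTwoArrow]; ring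
  rw [he]
  exact hc

/-- The intersection of `K` with the line `cross d = s`, in the coordinate along the line. -/
def slice (d : Plane) (K : Set Plane) (s : ℝ) : Set ℝ := {t | framePt d s t ∈ K}

/-- The length of a slice, in units of `‖d‖`. -/
noncomputable def sliceLen (d : Plane) (K : Set Plane) (s : ℝ) : ℝ :=
  (volume (slice d K s)).toReal

lemma measurableSet_frame {d : Plane} {S : Set Plane} (hS : MeasurableSet S) :
    MeasurableSet {z : ℝ × ℝ | framePt d z.1 z.2 ∈ S} :=
  (continuous_framePt d).measurable hS

lemma measurable_volume_slice {d : Plane} {S : Set Plane} (hS : MeasurableSet S) :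
    Measurable fun s => volume (slice d S s) :=
  measurable_measure_prodMk_left (measurableSet_frame hS)

lemma volume_eq_lintegral_slice {d : Plane} (hd : d ≠ 0) {S : Set Plane} (hS : MeasurableSet S) :
    volume S = ∫⁻ s, volume (slice d S s) := by
  have h1 : S = frameCoords d ⁻¹' {z : ℝ × ℝ | framePt d z.1 z.2 ∈ S} := by
    ext y
    simp only [mem_preimage, mem_ofPred_eq, framePt_frameCoords hd]
  conv_lhs => rw [h1]
  rw [(measurePreserving_frameCoords hd).measure_preimage
    (measurableSet_frame hS).nullMeasurableSet, Measure.volume_eq_prod,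
    Measure.prod_apply (measurableSet_frame hS)]
  rfl

lemma integrable_sliceLen {d : Plane} (hd : d ≠ 0) {S : Set Plane} (hS : MeasurableSet S)
    (hfin : volume S ≠ ⊤) : Integrable (sliceLen d S) := by
  refine integrable_toReal_of_lintegral_ne_top (measurable_volume_slice hS).aemeasurable ?_
  rwa [← volume_eq_lintegral_slice hd hS]

lemma toReal_volume_eq_integral {d : Plane} (hd : d ≠ 0) {S : Set Plane} (hS : MeasurableSet S)
    (hfin : volume S ≠ ⊤) : (volume S).toReal = ∫ s, sliceLen d S s := by
  have h := volume_eq_lintegral_slice hd hS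
  rw [h]
  refine (integral_toReal (measurable_volume_slice hS).aemeasurable ?_).symm
  exact ae_lt_top (measurable_volume_slice hS) (by rwa [← h])

lemma toReal_volume_cap {d : Plane} (hd : d ≠ 0) {K : Set Plane} (hK : IsCompact K) (σ : ℝ) :
    (volume (K ∩ {y | cross d y ≤ σ})).toReal = ∫ s in Iic σ, sliceLen d K s := by
  have hm : MeasurableSet {y | cross d y ≤ σ} :=
    (isClosed_le (by fun_prop) continuous_const).measurableSet
  rw [toReal_volume_eq_integral hd (hK.measurableSet.inter hm)
    ((measure_mono inter_subset_left).trans_lt hK.measure_lt_top).ne,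
    ← integral_indicator measurableSet_Iic]
  congr 1
  ext s
  by_cases hs : s ≤ σ
  · rw [indicator_of_mem (by exact hs), sliceLen, sliceLen]
    congr 2
    ext t
    simp [slice, cross_framePt hd, hs]
  · rw [indicator_of_notMem (by exact hs), sliceLen]
    have : slice d (K ∩ {y | cross d y ≤ σ}) s = ∅ := by
      ext t
      simp [slice, cross_framePt hd, hs]
    simp [this]

lemma isCompact_slice {d : Plane} (hd : d ≠ 0) {K : Set Plane} (hK : IsCompact K) (s : ℝ) :
    IsCompact (slice d K s) := by
  have : slice d K s ⊆ (fun y => (frameCoords d y).2) '' K := by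
    intro t ht
    refine ⟨_, ht, ?_⟩
    have h2 : ‖d‖ ^ 2 ≠ 0 := by positivity
    have h3 : ‖d‖ ^ 2 = d 0 ^ 2 + d 1 ^ 2 := by simp [EuclideanSpace.norm_sq_eq]
    rw [h3] at h2
    simp [framePt, frameCoords, rot, h3]
    field_simp
    ring
  refine (hK.image ?_).of_isClosed_subset ?_ this
  · unfold frameCoords; fun_prop
  · exact hK.isClosed.preimage ((continuous_framePt d).comp (by fun_prop : Continuous fun t => (s, t)))

lemma slice_eq_Icc {d : Plane} (hd : d ≠ 0) {K : Set Plane} (hK : IsCompact K)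
    (hv : Convex ℝ K) {s : ℝ} (hne : (slice d K s).Nonempty) :
    ∃ a b, a ≤ b ∧ slice d K s = Icc a b := by
  have hconv : Convex ℝ (slice d K s) := by
    intro t ht t' ht' a b ha hb hab
    have := hv ht ht' ha hb hab
    rw [framePt_combo, ← add_mul, hab, one_mul] at this
    exact this
  have h := eq_Icc_of_connected_compact ⟨hne, hconv.isPreconnected⟩ (isCompact_slice hd hK s)
  refine ⟨_, _, ?_, h⟩
  by_contra! hlt
  rw [h, Icc_eq_empty (not_le.2 hlt)] at hne
  exact not_nonempty_empty hne

lemma concaveOn_sliceLen {d : Plane} (hd : d ≠ 0) {K : Set Plane} (hK : IsCompact K)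
    (hv : Convex ℝ K) : ConcaveOn ℝ {s | (slice d K s).Nonempty} (sliceLen d K) := by
  constructor
  · rintro s ⟨t, ht⟩ s' ⟨t', ht'⟩ a b ha hb hab
    refine ⟨a * t + b * t', ?_⟩
    have := hv ht ht' ha hb hab
    rwa [framePt_combo] at this
  · intro s hs s' hs' a b ha hb hab
    obtain ⟨l, u, hlu, h⟩ := slice_eq_Icc hd hK hv hs
    obtain ⟨l', u', hlu', h'⟩ := slice_eq_Icc hd hK hv hs'
    have hsub : Icc (a * l + b * l') (a * u + b * u') ⊆ slice d K (a • s + b • s') := by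
      have hl : l ∈ slice d K s := by rw [h]; exact ⟨le_rfl, hlu⟩
      have hu : u ∈ slice d K s := by rw [h]; exact ⟨hlu, le_rfl⟩
      have hl' : l' ∈ slice d K s' := by rw [h']; exact ⟨le_rfl, hlu'⟩
      have hu' : u' ∈ slice d K s' := by rw [h']; exact ⟨hlu', le_rfl⟩
      have h1 := hv hl hl' ha hb hab
      have h2 := hv hu hu' ha hb hab
      rw [framePt_combo] at h1 h2
      have h1' : a * l + b * l' ∈ slice d K (a • s + b • s') := h1
      have h2' : a * u + b * u' ∈ slice d K (a • s + b • s') := h2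
      obtain ⟨l'', u'', _, h''⟩ := slice_eq_Icc hd hK hv ⟨_, h1'⟩
      rw [h''] at h1' h2' ⊢
      exact Icc_subset_Icc h1'.1 h2'.2
    have hm := ENNReal.toReal_mono (isCompact_slice hd hK _).measure_lt_top.ne
      (measure_mono (μ := volume) hsub)
    have e1 : 0 ≤ a * (u - l) := mul_nonneg ha (by linarith)
    have e2 : 0 ≤ b * (u' - l') := mul_nonneg hb (by linarith)
    rw [Real.volume_Icc, ENNReal.toReal_ofReal (by linarith)] at hm
    simp only [sliceLen, h, h', smul_eq_mul, Real.volume_Icc]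
    rw [ENNReal.toReal_ofReal (by linarith), ENNReal.toReal_ofReal (by linarith)]
    simp only [smul_eq_mul] at hm
    linarith

lemma slice_nonempty_mem_nhds {d : Plane} (hd : d ≠ 0) {K : Set Plane} {y : Plane}
    (hy : y ∈ interior K) : {s | (slice d K s).Nonempty} ∈ 𝓝 (cross d y) := by
  obtain ⟨t, ht⟩ := exists_framePt_eq hd y
  have hc : ContinuousAt (fun s => framePt d s t) (cross d y) := by
    unfold framePt; fun_prop
  have : ∀ᶠ s in 𝓝 (cross d y), framePt d s t ∈ K :=
    hc (by beta_reduce; rw [← ht]; exact mem_interior_iff_mem_nhds.1 hy)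
  filter_upwards [this] with s hs using ⟨t, hs⟩

/-- Fundamental theorem of calculus for the slice integral. Slice length is continuous at this level
because it is concave on the set of nonempty slices and the level is interior to that set. -/
lemma hasDerivAt_cap {d : Plane} (hd : d ≠ 0) {K : Set Plane} (hK : IsCompact K)
    (hv : Convex ℝ K) {y : Plane} (hy : y ∈ interior K) :
    HasDerivAt (fun σ => (volume (K ∩ {z | cross d z ≤ σ})).toReal) (sliceLen d K (cross d y))
      (cross d y) := by
  have hint := integrable_sliceLen hd hK.measurableSet hK.measure_lt_top.ne
  have hcont : ContinuousAt (sliceLen d K) (cross d y) :=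
    (concaveOn_sliceLen hd hK hv).continuousOn_interior.continuousAt
      (isOpen_interior.mem_nhds (mem_interior_iff_mem_nhds.2 (slice_nonempty_mem_nhds hd hy)))
  have h1 := intervalIntegral.integral_hasDerivAt_right (a := cross d y) (b := cross d y)
    (hint.intervalIntegrable) hint.aestronglyMeasurable.stronglyMeasurableAtFilter hcont
  have h2 := h1.const_add (∫ s in Iic (cross d y), sliceLen d K s)
  refine h2.congr_of_eventuallyEq (Eventually.of_forall fun σ => ?_)
  simp only [toReal_volume_cap hd hK]
  rw [← intervalIntegral.integral_Iic_sub_Iic hint.integrableOn hint.integrableOn]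
  ring

/-- By strict convexity the chord is the whole slice: if the slice extended further, an endpoint of
the chord would be interior. -/
lemma sliceLen_chord {K : Set Plane} (hK : StrictBody K) {p d : Plane} (hd : d ≠ 0)
    (hp : p ∈ frontier K) (hpd : p - d ∈ frontier K) : sliceLen d K (cross d p) = 1 := by
  obtain ⟨t, ht⟩ := exists_framePt_eq hd p
  have htd : p - d = framePt d (cross d p) (t - 1) := by
    conv_lhs => rw [ht]
    rw [← framePt_sub, one_smul]
  have h1 : t ∈ slice d K (cross d p) := by
    change framePt d (cross d p) t ∈ K
    rw [← ht]; exact hK.mem_of_frontier hp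
  have h2 : t - 1 ∈ slice d K (cross d p) := by
    change framePt d (cross d p) (t - 1) ∈ K
    rw [← htd]; exact hK.mem_of_frontier hpd
  obtain ⟨a, b, hab, h⟩ := slice_eq_Icc hd hK.compact hK.convex ⟨_, h1⟩
  have hinj : ∀ u v : ℝ, u ≠ v → framePt d (cross d p) u ≠ framePt d (cross d p) v := by
    intro u v huv he
    have : (u - v) • d = 0 := by
      have h0 : (u - v) • d = framePt d (cross d p) u - framePt d (cross d p) v := by
        simp only [framePt]; module
      rw [h0, he, sub_self]
    rcases smul_eq_zero.1 this with h0 | h0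
    · exact huv (by linarith)
    · exact hd h0
  have key : ∀ u v w : ℝ, u ∈ slice d K (cross d p) → w ∈ slice d K (cross d p) → u < v → v < w →
      framePt d (cross d p) v ∈ interior K := by
    intro u v w hu hw huv hvw
    have hwu : 0 < w - u := by linarith
    have := hK.strict hu hw (hinj _ _ (by linarith)) (a := (w - v) / (w - u))
      (b := (v - u) / (w - u)) (div_pos (by linarith) hwu) (div_pos (by linarith) hwu)
      (by field_simp; ring)
    rw [framePt_combo] at this
    convert this using 1
    congr 1 <;> field_simp <;> ring
  have hb : b = t := by
    rw [h] at h1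
    refine le_antisymm ?_ h1.2
    by_contra! hlt
    have := key (t - 1) t b h2 (by rw [h]; exact ⟨hab, le_rfl⟩) (by linarith) hlt
    rw [← ht] at this
    exact (hK.mem_frontier.1 hp).2 this
  have ha : a = t - 1 := by
    have h2' := h2
    rw [h] at h2'
    refine le_antisymm h2'.1 ?_
    by_contra! hlt
    have := key a (t - 1) t (by rw [h]; exact ⟨le_rfl, hab⟩) h1 hlt (by linarith)
    rw [← htd] at this
    exact (hK.mem_frontier.1 hpd).2 this
  rw [sliceLen, h, ha, hb, Real.volume_Icc]
  simp

lemma hasDerivAt_cap_chord {K : Set Plane} (hK : StrictBody K) {p d : Plane} (hd : d ≠ 0)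
    (hp : p ∈ frontier K) (hpd : p - d ∈ frontier K) :
    HasDerivAt (fun σ => (volume (K ∩ {z | cross d z ≤ σ})).toReal) 1 (cross d p) := by
  have hmid : p - (1 / 2 : ℝ) • d ∈ interior K := by
    have := hK.strict (hK.mem_of_frontier hp) (hK.mem_of_frontier hpd) (by rw [ne_comm, Ne, sub_eq_self]; exact hd)
      (a := 1 / 2) (b := 1 / 2) (by norm_num) (by norm_num) (by norm_num)
    convert this using 1
    module
  have h := hasDerivAt_cap hd hK.compact hK.convex hmid
  have e : cross d (p - (1 / 2 : ℝ) • d) = cross d p := by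
    rw [cross_sub_right, cross_smul_right, cross_self]; ring
  rwa [e, sliceLen_chord hK hd hp hpd] at h

/-! ### The covariogram near the origin determines the widths -/

lemma sliceLen_inter_vadd {d : Plane} (hd : d ≠ 0) {K : Set Plane} (hK : IsCompact K)
    (hv : Convex ℝ K) {r : ℝ} (hr : 0 ≤ r) (s : ℝ) :
    sliceLen d (K ∩ ((r • d) +ᵥ K)) s = sliceLen d K s - min (sliceLen d K s) r := by
  have hsl : slice d (K ∩ ((r • d) +ᵥ K)) s = slice d K s ∩ {t | t - r ∈ slice d K s} := by
    ext t
    simp only [slice, mem_inter_iff, mem_ofPred_eq, mem_vadd_set_iff_neg_vadd_mem, vadd_eq_add,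
      ← framePt_sub]
    rw [neg_add_eq_sub]
  by_cases hne : (slice d K s).Nonempty
  · obtain ⟨a, b, hab, h⟩ := slice_eq_Icc hd hK hv hne
    have : slice d (K ∩ ((r • d) +ᵥ K)) s = Icc (a + r) b := by
      rw [hsl, h]
      ext t
      simp only [mem_inter_iff, mem_Icc, mem_ofPred_eq]
      constructor
      · rintro ⟨⟨_, _⟩, _, _⟩; constructor <;> linarith
      · rintro ⟨_, _⟩; refine ⟨⟨?_, ?_⟩, ?_, ?_⟩ <;> linarith
    rw [sliceLen, sliceLen, this, h, Real.volume_Icc, Real.volume_Icc,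
      ENNReal.toReal_ofReal (by linarith : 0 ≤ b - a)]
    rcases le_total (b - a) r with hle | hle
    · rw [min_eq_left hle, ENNReal.ofReal_of_nonpos (by linarith)]; simp
    · rw [min_eq_right hle, ENNReal.toReal_ofReal (by linarith)]; ring
  · rw [not_nonempty_iff_eq_empty] at hne
    have h0 : sliceLen d K s = 0 := by simp [sliceLen, hne]
    rw [h0, min_eq_left hr, sliceLen, hsl, hne]
    simp

lemma sliceLen_nonneg (d : Plane) (K : Set Plane) (s : ℝ) : 0 ≤ sliceLen d K s :=
  ENNReal.toReal_nonneg

lemma covariogram_zero (K : Set Plane) : covariogram K 0 = (volume K).toReal := by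
  simp [covariogram]

lemma covariogram_sub {d : Plane} (hd : d ≠ 0) {K : Set Plane} (hK : IsCompact K)
    (hv : Convex ℝ K) {r : ℝ} (hr : 0 ≤ r) :
    covariogram K 0 - covariogram K (r • d) = ∫ s, min (sliceLen d K s) r := by
  have hfin : volume (K ∩ ((r • d) +ᵥ K)) ≠ ⊤ :=
    ((measure_mono inter_subset_left).trans_lt hK.measure_lt_top).ne
  have hms : MeasurableSet (K ∩ ((r • d) +ᵥ K)) :=
    hK.measurableSet.inter (hK.vadd _).measurableSet
  rw [covariogram_zero, covariogram, toReal_volume_eq_integral hd hK.measurableSet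
    hK.measure_lt_top.ne, toReal_volume_eq_integral hd hms hfin, ← integral_sub
    (integrable_sliceLen hd hK.measurableSet hK.measure_lt_top.ne)
    (integrable_sliceLen hd hms hfin)]
  congr 1
  ext s
  rw [sliceLen_inter_vadd hd hK hv hr]
  ring

lemma sliceLen_pos {d : Plane} (hd : d ≠ 0) {K : Set Plane} (hK : IsCompact K) {y : Plane}
    (hy : y ∈ interior K) : 0 < sliceLen d K (cross d y) := by
  obtain ⟨t, ht⟩ := exists_framePt_eq hd y
  have hc : ContinuousAt (fun t => framePt d (cross d y) t) t := by
    unfold framePt; fun_prop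
  have hn : slice d K (cross d y) ∈ 𝓝 t :=
    hc (by beta_reduce; rw [← ht]; exact mem_interior_iff_mem_nhds.1 hy)
  exact ENNReal.toReal_pos (Measure.measure_pos_of_mem_nhds _ hn).ne'
    (isCompact_slice hd hK _).measure_lt_top.ne

/-- The difference quotient is `∫ min(n ℓ(s), 1) ds` with `ℓ` the slice length. By dominated
convergence it tends to the length of the interval where `ℓ > 0`, the width of `K`. -/
lemma tendsto_covariogram_width {d : Plane} (hd : d ≠ 0) {K : Set Plane} (hK : IsCompact K)
    (hv : Convex ℝ K) (hint : (interior K).Nonempty) {α β : ℝ}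
    (hα : IsLeast (cross d '' K) α) (hβ : IsGreatest (cross d '' K) β) :
    Tendsto (fun n : ℕ => ((n : ℝ) + 1) * (covariogram K 0 - covariogram K ((1 / ((n : ℝ) + 1)) • d)))
      atTop (𝓝 (β - α)) := by
  have hsupp : ∀ s, s ∉ Icc α β → sliceLen d K s = 0 := by
    intro s hs
    have : slice d K s = ∅ := by
      by_contra hne
      obtain ⟨t, ht⟩ := nonempty_iff_ne_empty.2 hne
      have hm : s ∈ cross d '' K := ⟨_, ht, cross_framePt hd s t⟩
      exact hs ⟨hα.2 hm, hβ.2 hm⟩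
    simp [sliceLen, this]
  have hpos : ∀ s ∈ Ioo α β, 0 < sliceLen d K s := by
    intro s hs
    obtain ⟨z, hz⟩ := hint
    -- The sign condition puts `s` strictly between the levels of `z` and `y`, so the segment from
    -- the interior point `z` to `y` has an interior point at level `s`.
    have key : ∀ y ∈ K, (s - cross d z) * (cross d y - s) > 0 → 0 < sliceLen d K s := by
      intro y hy h
      have h0 : cross d y - cross d z ≠ 0 := by
        intro h0
        have : cross d y - s = -(s - cross d z) := by linarith
        rw [this] at h
        nlinarith [sq_nonneg (s - cross d z)]
      have hq1 : 0 < (cross d y - s) / (cross d y - cross d z) := by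
        rw [← mul_div_mul_left (cross d y - s) _ (c := s - cross d z) (by rintro h1; simp [h1] at h)]
        apply div_pos h
        nlinarith [sq_nonneg (s - cross d z)]
      have hq2 : 0 ≤ (s - cross d z) / (cross d y - cross d z) := by
        rw [← mul_div_mul_left (s - cross d z) _ (c := cross d y - s) (by rintro h1; simp [h1] at h)]
        apply div_nonneg (by linarith)
        nlinarith [sq_nonneg (cross d y - s)]
      have := hv.combo_interior_self_mem_interior hz hy hq1 hq2 (by field_simp; ring)
      have h2 := sliceLen_pos hd hK this
      rw [cross_add_right, cross_smul_right, cross_smul_right] at h2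
      convert h2 using 2
      field_simp
      ring
    rcases lt_trichotomy s (cross d z) with h | h | h
    · obtain ⟨y, hy, hye⟩ := hα.1
      exact key y hy (by rw [hye]; nlinarith [hs.1])
    · rw [h]; exact sliceLen_pos hd hK hz
    · obtain ⟨y, hy, hye⟩ := hβ.1
      exact key y hy (by rw [hye]; nlinarith [hs.2])
  have hαβ : α ≤ β := hα.2 hβ.1
  have hlim : ∫ s, (Ioo α β).indicator (fun _ => (1 : ℝ)) s = β - α := by
    rw [integral_indicator measurableSet_Ioo]
    simp [hαβ]
  rw [← hlim]
  have hrw : ∀ n : ℕ, ((n : ℝ) + 1) *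
      (covariogram K 0 - covariogram K ((1 / ((n : ℝ) + 1)) • d)) =
      ∫ s, min (((n : ℝ) + 1) * sliceLen d K s) 1 := by
    intro n
    have hn : (0 : ℝ) < (n : ℝ) + 1 := by positivity
    rw [covariogram_sub hd hK hv (by positivity), ← integral_const_mul]
    congr 1
    ext s
    rw [mul_min_of_nonneg _ _ hn.le]
    congr 1
    field_simp
  simp only [hrw]
  have hmeas : Measurable (sliceLen d K) :=
    (measurable_volume_slice hK.measurableSet).ennreal_toReal
  refine tendsto_integral_of_dominated_convergence ((Icc α β).indicator fun _ => (1 : ℝ)) ?_ ?_ ?_ ?_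
  · intro n
    exact ((hmeas.const_mul _).min measurable_const).aestronglyMeasurable
  · exact (integrable_indicator_iff measurableSet_Icc).2 (by simp)
  · intro n
    refine Eventually.of_forall fun s => ?_
    have h0 : 0 ≤ ((n : ℝ) + 1) * sliceLen d K s :=
      mul_nonneg (by positivity) (sliceLen_nonneg _ _ _)
    rw [Real.norm_of_nonneg (le_min h0 zero_le_one)]
    by_cases hs : s ∈ Icc α β
    · rw [indicator_of_mem hs]; exact min_le_right _ _
    · rw [hsupp s hs]; simp [hs]
  · have hae : ∀ᵐ s : ℝ, s ≠ α ∧ s ≠ β := by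
      have h1 : ∀ᵐ s : ℝ, s ≠ α := by simp [ae_iff]
      have h2 : ∀ᵐ s : ℝ, s ≠ β := by simp [ae_iff]
      filter_upwards [h1, h2] with s h1 h2 using ⟨h1, h2⟩
    filter_upwards [hae] with s hs
    by_cases hsm : s ∈ Ioo α β
    · rw [indicator_of_mem hsm]
      have hp := hpos s hsm
      have : Tendsto (fun n : ℕ => ((n : ℝ) + 1) * sliceLen d K s) atTop atTop :=
        (tendsto_atTop_add_const_right _ _ tendsto_natCast_atTop_atTop).atTop_mul_const hp
      refine tendsto_const_nhds.congr' ?_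
      filter_upwards [this.eventually_ge_atTop 1] with n hn
      rw [min_eq_right hn]
    · have : s ∉ Icc α β := by
        intro h
        exact hsm ⟨lt_of_le_of_ne h.1 hs.1.symm, lt_of_le_of_ne h.2 hs.2⟩
      rw [indicator_of_notMem hsm, hsupp s this]
      simp

/-! ### Covariogram and inscribed parallelograms -/

/-- An upper bound for the covariogram, sharp at `y = x` if the line `cross d = s` contains the
side `d` of a parallelogram with sides `d`, `x` inscribed in `K`. -/
noncomputable def capBound (K : Set Plane) (d : Plane) (s : ℝ) (y : Plane) : ℝ :=
  (volume (K ∩ {z | s < cross d z})).toReal + (volume (K ∩ {z | cross d z ≤ s - cross d y})).toReal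

lemma volume_vadd_inter (K : Set Plane) (d y : Plane) (s : ℝ) :
    volume ((y +ᵥ K) ∩ {z | cross d z ≤ s}) = volume (K ∩ {z | cross d z ≤ s - cross d y}) := by
  have : (y +ᵥ K) ∩ {z | cross d z ≤ s} = y +ᵥ (K ∩ {z | cross d z ≤ s - cross d y}) := by
    ext z
    simp only [mem_inter_iff, mem_vadd_set_iff_neg_vadd_mem, vadd_eq_add, mem_ofPred_eq,
      cross_add_right, cross_neg_right]
    constructor
    · rintro ⟨h1, h2⟩; exact ⟨h1, by linarith⟩
    · rintro ⟨h1, h2⟩; exact ⟨h1, by linarith⟩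
  rw [this, measure_vadd]

/-- Bound `K ∩ (K + y)` by `K` above the line and by `K + y` below it. -/
lemma covariogram_le_capBound {K : Set Plane} (hK : IsCompact K) (d : Plane) (s : ℝ) (y : Plane) :
    covariogram K y ≤ capBound K d s y := by
  have hfin : ∀ S : Set Plane, volume (K ∩ S) ≠ ⊤ := fun S =>
    ((measure_mono inter_subset_left).trans_lt hK.measure_lt_top).ne
  rw [covariogram, capBound, ← volume_vadd_inter, ← ENNReal.toReal_add (hfin _)
    (by rw [volume_vadd_inter]; exact hfin _)]
  refine ENNReal.toReal_mono (ENNReal.add_ne_top.2 ⟨hfin _,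
    by rw [volume_vadd_inter]; exact hfin _⟩) ((measure_mono ?_).trans (measure_union_le _ _))
  rintro z ⟨h1, h2⟩
  rcases lt_or_ge s (cross d z) with h | h
  · exact Or.inl ⟨h1, h⟩
  · exact Or.inr ⟨h2, h⟩

/-- Both inclusions behind `covariogram_le_capBound` become equalities, by `Inscribed.sub_mem` above
the side and `Inscribed.mem_of_sub_mem` below it. -/
lemma Inscribed.covariogram_eq {K : Set Plane} (hK : StrictBody K) {p d x : Plane}
    (h : Inscribed K p d x) : covariogram K x = capBound K d (cross d p) x := by
  refine le_antisymm (covariogram_le_capBound hK.compact _ _ _) ?_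
  have hfin : ∀ S : Set Plane, volume (K ∩ S) ≠ ⊤ := fun S =>
    ((measure_mono inter_subset_left).trans_lt hK.compact.measure_lt_top).ne
  rw [covariogram, capBound, ← volume_vadd_inter, ← ENNReal.toReal_add (hfin _)
    (by rw [volume_vadd_inter]; exact hfin _), ← measure_union]
  · refine ENNReal.toReal_mono (hfin _) (measure_mono ?_)
    rintro z (⟨h1, h2⟩ | ⟨h1, h2⟩)
    · refine ⟨h1, ?_⟩
      rw [mem_ofPred_eq] at h2
      rw [mem_vadd_set_iff_neg_vadd_mem, vadd_eq_add, neg_add_eq_sub]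
      exact h.sub_mem hK h1 (by rw [cross_sub_right]; linarith)
    · refine ⟨?_, h1⟩
      rw [mem_ofPred_eq] at h2
      rw [mem_vadd_set_iff_neg_vadd_mem, vadd_eq_add, neg_add_eq_sub] at h1
      exact h.mem_of_sub_mem hK h1 (by rw [cross_sub_right]; linarith)
  · rw [Set.disjoint_left]
    rintro z ⟨_, h1⟩ ⟨_, h2⟩
    rw [mem_ofPred_eq] at h1 h2
    linarith
  · exact (hK.compact.vadd _).measurableSet.inter
      (isClosed_le (by fun_prop) continuous_const).measurableSet

lemma Inscribed.ne_zero {K : Set Plane} {p d x : Plane} (h : Inscribed K p d x) :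
    d ≠ 0 ∧ x ≠ 0 := by
  constructor
  · rintro rfl; exact absurd h.pos (by simp)
  · rintro rfl; exact absurd h.pos (by simp)

/-- Only the lower cap varies. At `x` its bounding line carries the opposite side of the
parallelogram, a chord of length one in units of `‖d‖`. -/
lemma Inscribed.hasDerivAt_capBound {K : Set Plane} (hK : StrictBody K) {p d x : Plane}
    (h : Inscribed K p d x) (u : Plane) :
    HasDerivAt (fun t : ℝ => capBound K d (cross d p) (x + t • u)) (-cross d u) 0 := by
  have h1 := hasDerivAt_cap_chord hK h.ne_zero.1 h.mem₃ (by convert h.mem₄ using 1; abel)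
  have h2 : HasDerivAt (fun t : ℝ => cross d p - cross d (x + t • u)) (-cross d u) 0 := by
    have : (fun t : ℝ => cross d p - cross d (x + t • u)) =
        fun t => (cross d p - cross d x) - t * cross d u := by
      ext t; rw [cross_add_right, cross_smul_right]; ring
    rw [this]
    simpa using ((hasDerivAt_id (0 : ℝ)).mul_const (cross d u)).const_sub (cross d p - cross d x)
  have h3 := HasDerivAt.comp (0 : ℝ) (by simpa [cross_sub_right] using h1) h2
  rw [one_mul] at h3
  exact h3.const_add (volume (K ∩ {z | cross d p < cross d z})).toReal

lemma continuous_covariogram {K : Set Plane} (hK : IsCompact K) (hv : Convex ℝ K) :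
    Continuous (covariogram K) := by
  have hrw : covariogram K = fun y => ∫ z in K, K.indicator (fun _ => (1 : ℝ)) (z - y) := by
    ext y
    have : (fun z => K.indicator (fun _ => (1 : ℝ)) (z - y)) =
        (y +ᵥ K).indicator (fun _ => (1 : ℝ)) := by
      ext z
      have : z ∈ y +ᵥ K ↔ z - y ∈ K := by
        rw [mem_vadd_set_iff_neg_vadd_mem, vadd_eq_add, neg_add_eq_sub]
      by_cases h : z - y ∈ K
      · rw [indicator_of_mem h, indicator_of_mem (this.2 h)]
      · rw [indicator_of_notMem h, indicator_of_notMem (fun h' => h (this.1 h'))]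
    rw [this, integral_indicator (hK.vadd y).measurableSet, Measure.restrict_restrict
      (hK.vadd y).measurableSet]
    simp [covariogram, Measure.real, inter_comm]
  rw [hrw, continuous_iff_continuousAt]
  intro x
  refine continuousAt_of_dominated (bound := fun _ => 1) ?_ ?_ ?_ ?_
  · refine Eventually.of_forall fun y => Measurable.aestronglyMeasurable ?_
    exact (measurable_const.indicator hK.measurableSet).comp (measurable_id.sub_const y)
  · refine Eventually.of_forall fun y => Eventually.of_forall fun z => ?_
    by_cases h : z - y ∈ K <;> simp [h]
  · exact integrableOn_const hK.measure_lt_top.ne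
  · have hnull : volume (x +ᵥ frontier K) = 0 := by
      rw [measure_vadd]; exact hv.addHaar_frontier volume
    refine ae_restrict_of_ae ?_
    filter_upwards [compl_mem_ae_iff.2 hnull] with z hz
    have hz' : z - x ∉ frontier K := by
      intro h
      apply hz
      rw [mem_vadd_set_iff_neg_vadd_mem, vadd_eq_add, neg_add_eq_sub]
      exact h
    have hc : ContinuousAt (fun y => z - y) x := by fun_prop
    exact ContinuousAt.comp (f := fun y => z - y)
      (ContinuousOn.continuousAt_indicator continuousOn_const hz') hc

lemma isCompact_diffBody {K : Set Plane} (hK : IsCompact K) : IsCompact (diffBody K) := by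
  rw [diffBody, sub_eq_add_neg]
  exact hK.add hK.neg

lemma exists_interior_sub {K : Set Plane} (hv : Convex ℝ K) (hint : (interior K).Nonempty)
    {x : Plane} (hx : x ∈ interior (diffBody K)) : ∃ z ∈ interior K, z - x ∈ interior K := by
  obtain ⟨ε, hε, a, ha, b, hb, hab⟩ := exists_pos_add_smul_mem hx x
  obtain ⟨c, hc⟩ := hint
  -- Write `(1 + ε) x = a - b` and contract `a` and `b` towards `c` by the factor `1 / (1 + ε)`; the
  -- images are interior and differ by `x`.
  have key : ∀ y ∈ K, (ε / (1 + ε)) • c + (1 / (1 + ε)) • y ∈ interior K := fun y hy =>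
    hv.combo_interior_self_mem_interior hc hy (by positivity) (by positivity) (by field_simp; ring)
  refine ⟨_, key a ha, ?_⟩
  convert key b hb using 1
  have hab' : a - b = x + ε • x := hab
  have hx' : x = (1 / (1 + ε)) • (a - b) := by
    rw [hab']
    match_scalars
    field_simp
  rw [hx']
  module

lemma exists_ball_of_mem_interior_diffBody {K : Set Plane} (hv : Convex ℝ K)
    (hint : (interior K).Nonempty) {x : Plane} (hx : x ∈ interior (diffBody K)) :
    ∃ z, ∃ ρ > 0, Metric.closedBall z ρ ⊆ K ∧
      ∀ y ∈ Metric.closedBall z ρ, ∀ x', dist x' x ≤ ρ → y - x' ∈ K := by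
  obtain ⟨z, h1, h2⟩ := exists_interior_sub hv hint hx
  obtain ⟨r1, hr1, hb1⟩ := Metric.nhds_basis_closedBall.mem_iff.1 (mem_interior_iff_mem_nhds.1 h1)
  obtain ⟨r2, hr2, hb2⟩ := Metric.nhds_basis_closedBall.mem_iff.1 (mem_interior_iff_mem_nhds.1 h2)
  refine ⟨z, min r1 (r2 / 2), by positivity, fun y hy => hb1 ?_, fun y hy x' hx' => hb2 ?_⟩
  · exact Metric.closedBall_subset_closedBall (min_le_left _ _) hy
  · rw [Metric.mem_closedBall] at hy ⊢
    calc dist (y - x') (z - x) ≤ dist y z + dist x' x := dist_sub_sub_le _ _ _ _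
      _ ≤ r2 / 2 + r2 / 2 := add_le_add (hy.trans (min_le_right _ _)) (hx'.trans (min_le_right _ _))
      _ = r2 := by ring

/-- If the covariogram plus `M ‖· - x‖ ^ 2` has a local minimum at `x₁`, then `M` and `x` determine
the second side of the parallelogram. -/
lemma Inscribed.cross_eq_of_localMin {K : Set Plane} (hK : StrictBody K) {p d x x₁ : Plane}
    (h : Inscribed K p d x₁) {M : ℝ}
    (hmin : ∀ᶠ y in 𝓝 x₁,
      covariogram K x₁ + M * ‖x₁ - x‖ ^ 2 ≤ covariogram K y + M * ‖y - x‖ ^ 2) (u : Plane) :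
    cross d u = M * (2 * inner ℝ (x₁ - x) u) := by
  have h1 := h.hasDerivAt_capBound hK u
  have h2 : HasDerivAt (fun t : ℝ => M * ‖x₁ + t • u - x‖ ^ 2) (M * (2 * inner ℝ (x₁ - x) u)) 0 := by
    have h3 : HasDerivAt (fun t : ℝ => x₁ + t • u - x) u 0 := by
      simpa using (((hasDerivAt_id (0 : ℝ)).smul_const u).const_add x₁).sub_const x
    simpa using (h3.norm_sq).const_mul M
  -- Replacing the covariogram by a larger function with the same value at `x₁` keeps the local
  -- minimum, and the new function is differentiable.
  have hloc : IsLocalMin (fun t : ℝ => capBound K d (cross d p) (x₁ + t • u) +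
      M * ‖x₁ + t • u - x‖ ^ 2) 0 := by
    have hc : ContinuousAt (fun t : ℝ => x₁ + t • u) 0 := by fun_prop
    have hev := hc.eventually (p := fun y => covariogram K x₁ + M * ‖x₁ - x‖ ^ 2 ≤
      covariogram K y + M * ‖y - x‖ ^ 2) (by simpa using hmin)
    filter_upwards [hev] with t ht
    have h4 := covariogram_le_capBound hK.compact d (cross d p) (x₁ + t • u)
    simp only [zero_smul, add_zero]
    rw [← h.covariogram_eq hK]
    linarith
  have := hloc.hasDerivAt_eq_zero (h1.add h2)
  linarith

/-- At a local minimum of the covariogram plus `M ‖· - x‖ ^ 2`, the stationarity equation expresses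
`d` through `M`, `x` and `x₁` alone. As the covariograms agree, both bodies have the same `d` there.
-/
lemma exists_common_inscribed {K H : Set Plane} (hK : StrictBody K) (hH : StrictBody H) {x : Plane}
    (hx : x ≠ 0) (hxK : x ∈ interior (diffBody K)) (hxH : x ∈ interior (diffBody H))
    (hg : ∀ᶠ y in 𝓝 x, covariogram K y = covariogram H y) {δ : ℝ} (hδ : 0 < δ) :
    ∃ x₁, dist x₁ x < δ ∧ ∃ p p' d, Inscribed K p d x₁ ∧ Inscribed H p' d x₁ := by
  obtain ⟨z, ρ, hρ, hb1, hb2⟩ :=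
    exists_ball_of_mem_interior_diffBody hK.convex hK.interior_nonempty hxK
  obtain ⟨z', ρ', hρ', hb1', hb2'⟩ :=
    exists_ball_of_mem_interior_diffBody hH.convex hH.interior_nonempty hxH
  obtain ⟨r, hr, hball⟩ := Metric.eventually_nhds_iff.1 (hg.and (eventually_ne_nhds hx))
  obtain ⟨ε, hε, hεlt⟩ := exists_between
    (show 0 < min (min δ r) (min ρ ρ') by positivity)
  simp only [lt_min_iff] at hεlt
  obtain ⟨⟨h1, h2⟩, h3, h4⟩ := hεlt
  -- On the sphere of radius `ε` the penalty `M ε ^ 2` exceeds the value at the centre and the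
  -- covariogram is nonnegative, so the minimum lies in the open ball.
  set M := (covariogram K x + 1) / ε ^ 2 with hM
  have hcont : Continuous fun y => covariogram K y + M * ‖y - x‖ ^ 2 :=
    (continuous_covariogram hK.compact hK.convex).add (by fun_prop)
  obtain ⟨x₁, hx₁, hmin⟩ := (isCompact_closedBall x ε).exists_isMinOn ⟨x, by simp [hε.le]⟩
    hcont.continuousOn
  have hlt : dist x₁ x < ε := by
    refine lt_of_le_of_ne hx₁ fun he => ?_
    have := hmin (show x ∈ Metric.closedBall x ε by simp [hε.le])
    simp only [mem_ofPred_eq, sub_self, norm_zero] at this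
    rw [← dist_eq_norm, he, hM, div_mul_cancel₀ _ (by positivity)] at this
    have h0 : 0 ≤ covariogram K x₁ := ENNReal.toReal_nonneg
    simp at this
    linarith
  have hx₁r := hball (hlt.trans h2)
  obtain ⟨p, d, hp⟩ := exists_inscribed hK hx₁r.2 hρ hb1
    (fun y hy => hb2 y hy _ (hlt.trans h3).le)
  obtain ⟨p', d', hp'⟩ := exists_inscribed hH hx₁r.2 hρ' hb1'
    (fun y hy => hb2' y hy _ (hlt.trans h4).le)
  have hnh : Metric.ball x ε ∈ 𝓝 x₁ := Metric.isOpen_ball.mem_nhds hlt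
  have hd : d = d' := by
    refine eq_of_cross_eq fun u => ?_
    rw [hp.cross_eq_of_localMin hK (x := x) (M := M), hp'.cross_eq_of_localMin hH (x := x) (M := M)]
    · filter_upwards [hnh] with y hy
      rw [← hx₁r.1, ← (hball ((Metric.mem_ball.1 hy).trans h2)).1]
      exact hmin (Metric.ball_subset_closedBall hy)
    · filter_upwards [hnh] with y hy
      exact hmin (Metric.ball_subset_closedBall hy)
  subst hd
  exact ⟨x₁, hlt.trans h1, p, p', d, hp, hp'⟩

/-- The strip in direction `x₁` contains a fixed diameter perpendicular to `x`. This gives a lower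
bound that equals `2 ρ ‖x‖` at `x` and exceeds half of it nearby, so limits of inscribed
parallelograms do not degenerate. -/
lemma eventually_le_cross_of_inscribed {K : Set Plane} (hK : StrictBody K) {x : Plane}
    (hx : x ≠ 0) (hxK : x ∈ interior (diffBody K)) :
    ∃ c > 0, ∀ᶠ x₁ in 𝓝 x, ∀ p d, Inscribed K p d x₁ → c ≤ cross d x₁ := by
  obtain ⟨z, ρ, hρ, hb1, hb2⟩ :=
    exists_ball_of_mem_interior_diffBody hK.convex hK.interior_nonempty hxK
  have hxn : 0 < ‖x‖ := norm_pos_iff.2 hx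
  have hrn : ‖rot x‖ = ‖x‖ := by simp [rot, EuclideanSpace.norm_eq, add_comm]
  refine ⟨ρ * ‖x‖, by positivity, ?_⟩
  have hc : Continuous fun x₁ => -(2 * ρ / ‖x‖) * cross (rot x) x₁ := by fun_prop
  have h1 : ∀ᶠ x₁ in 𝓝 x, ρ * ‖x‖ < -(2 * ρ / ‖x‖) * cross (rot x) x₁ := by
    refine hc.continuousAt.eventually_const_lt ?_
    beta_reduce
    rw [cross_rot_left]
    have : -(2 * ρ / ‖x‖) * -‖x‖ ^ 2 = 2 * (ρ * ‖x‖) := by field_simp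
    rw [this]
    have : 0 < ρ * ‖x‖ := by positivity
    linarith
  filter_upwards [h1, Metric.closedBall_mem_nhds x hρ] with x₁ h1 h2 p d hI
  have hmem : ∀ σ : ℝ, |σ| = 1 → z + (σ * (ρ / ‖x‖)) • rot x ∈ Metric.closedBall z ρ := by
    intro σ hσ
    rw [Metric.mem_closedBall, dist_eq_norm]
    simp [norm_smul, hrn, abs_of_pos hρ, hσ]
    field_simp; exact le_rfl
  have m1 := hmem 1 (by simp)
  have m2 := hmem (-1) (by simp)
  have a1 := (hI.range hK (hb1 m1) (hb2 _ m1 _ h2)).1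
  have a2 := (hI.range hK (hb1 m2) (hb2 _ m2 _ h2)).2
  rw [cross_sub_left, cross_add_left, cross_smul_left] at a1 a2
  have : -(2 * ρ / ‖x‖) * cross (rot x) x₁ = -1 * (ρ / ‖x‖) * cross (rot x) x₁ -
    1 * (ρ / ‖x‖) * cross (rot x) x₁ := by ring
  linarith

/-- Equality of covariograms near `x` transfers the parallelogram with side `x` inscribed in `K`
to a translate inscribed in `H`. -/
theorem Inscribed.transfer {K H : Set Plane} (hK : StrictBody K) (hH : StrictBody H)
    {p d x : Plane} (h : Inscribed K p d x) (hxK : x ∈ interior (diffBody K))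
    (hxH : x ∈ interior (diffBody H)) (hg : ∀ᶠ y in 𝓝 x, covariogram K y = covariogram H y) :
    ∃ p', Inscribed H p' d x := by
  have hx := h.ne_zero.2
  obtain ⟨c, hc, hev⟩ := eventually_le_cross_of_inscribed hK hx hxK
  obtain ⟨r, hr, hball⟩ := Metric.eventually_nhds_iff.1 hev
  -- `T` consists of tuples `(x₁, p, p', d)` with uniformly nondegenerate parallelograms in both
  -- bodies. It is compact, so its projection to `x₁` is closed and contains `x`.
  set T : Set (Plane × Plane × Plane × Plane) :=
    (Metric.closedBall x 1 ×ˢ K ×ˢ H ×ˢ diffBody K) ∩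
    {w | c ≤ cross w.2.2.2 w.1 ∧
      (w.2.1 ∈ frontier K ∧ w.2.1 - w.2.2.2 ∈ frontier K ∧ w.2.1 - w.1 ∈ frontier K ∧
        w.2.1 - w.2.2.2 - w.1 ∈ frontier K) ∧
      w.2.2.1 ∈ frontier H ∧ w.2.2.1 - w.2.2.2 ∈ frontier H ∧ w.2.2.1 - w.1 ∈ frontier H ∧
        w.2.2.1 - w.2.2.2 - w.1 ∈ frontier H} with hT
  have hTc : IsCompact T := by
    refine ((isCompact_closedBall x 1).prod (hK.compact.prod (hH.compact.prod
      (isCompact_diffBody hK.compact)))).inter_right ?_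
    have fr : ∀ (S : Set Plane) (f : Plane × Plane × Plane × Plane → Plane), Continuous f →
        IsClosed {w | f w ∈ frontier S} := fun S f hf => isClosed_frontier.preimage hf
    refine (isClosed_le (f := fun _ => c) (g := fun w : Plane × Plane × Plane × Plane =>
      cross w.2.2.2 w.1) (by fun_prop) (by fun_prop)).inter (IsClosed.inter ?_ ?_)
    · exact (fr _ _ (by fun_prop)).inter ((fr _ _ (by fun_prop)).inter
        ((fr _ _ (by fun_prop)).inter (fr _ _ (by fun_prop))))
    · exact (fr _ _ (by fun_prop)).inter ((fr _ _ (by fun_prop)).inter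
        ((fr _ _ (by fun_prop)).inter (fr _ _ (by fun_prop))))
  have hcl : x ∈ closure (Prod.fst '' T) := by
    rw [Metric.mem_closure_iff]
    intro ε hε
    obtain ⟨x₁, hx₁, p₁, p₁', d₁, h1, h2⟩ := exists_common_inscribed hK hH hx hxK hxH hg
      (show 0 < min ε (min r 1) by positivity)
    simp only [lt_min_iff] at hx₁
    refine ⟨x₁, ⟨(x₁, p₁, p₁', d₁), ⟨⟨hx₁.2.2.le, hK.mem_of_frontier h1.mem₁,
      hH.mem_of_frontier h2.mem₁, ?_⟩, hball hx₁.2.1 _ _ h1,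
      ⟨h1.mem₁, h1.mem₂, h1.mem₃, h1.mem₄⟩, h2.mem₁, h2.mem₂, h2.mem₃, h2.mem₄⟩, rfl⟩,
      by rw [dist_comm]; exact hx₁.1⟩
    exact ⟨p₁, hK.mem_of_frontier h1.mem₁, p₁ - d₁, hK.mem_of_frontier h1.mem₂, by simp⟩
  rw [(hTc.image continuous_fst).isClosed.closure_eq] at hcl
  obtain ⟨⟨x₀, p₀, p₀', d₀⟩, ⟨-, h1, ⟨k1, k2, k3, k4⟩, h1', h2', h3', h4'⟩, rfl⟩ := hcl
  have hI : Inscribed K p₀ d₀ x₀ := ⟨hc.trans_le h1, k1, k2, k3, k4⟩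
  obtain ⟨-, rfl⟩ := h.unique hK hI
  exact ⟨p₀', hc.trans_le h1, h1', h2', h3', h4'⟩

/-! ### Rays and supporting functionals -/

lemma exists_frontier_ray {L : Set Plane} (hL : IsCompact L) {o v : Plane} (ho : o ∈ L)
    (hv : v ≠ 0) : ∃ t : ℝ, o + t • v ∈ frontier L ∧ ∀ s : ℝ, o + s • v ∈ L → s ≤ t := by
  have hv2 : ‖v‖ ^ 2 ≠ 0 := by positivity
  have hc : IsCompact {t : ℝ | o + t • v ∈ L} := by
    have hcont : Continuous fun y : Plane => inner ℝ (y - o) v / ‖v‖ ^ 2 := by fun_prop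
    refine (hL.image hcont).of_isClosed_subset (hL.isClosed.preimage (by fun_prop)) ?_
    intro t ht
    refine ⟨_, ht, ?_⟩
    simp only [add_sub_cancel_left, real_inner_smul_left, real_inner_self_eq_norm_sq]
    field_simp
  obtain ⟨t, ht, hmax⟩ := hc.exists_isGreatest ⟨0, by simpa using ho⟩
  refine ⟨t, ?_, fun s hs => hmax hs⟩
  rw [hL.isClosed.frontier_eq]
  refine ⟨ht, fun hint => ?_⟩
  obtain ⟨ε, hε, hm⟩ := exists_pos_add_smul_mem hint v
  have : t + ε ≤ t := hmax (show o + (t + ε) • v ∈ L by rwa [add_smul, ← add_assoc])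
  linarith

lemma exists_frontier_ray_of_interior {L : Set Plane} (hL : IsCompact L) {o v : Plane}
    (ho : o ∈ interior L) (hv : v ≠ 0) :
    ∃ t : ℝ, 0 < t ∧ o + t • v ∈ frontier L ∧ ∀ s : ℝ, o + s • v ∈ L → s ≤ t := by
  obtain ⟨t, h1, h2⟩ := exists_frontier_ray hL (interior_subset ho) hv
  obtain ⟨ε, hε, hm⟩ := exists_pos_add_smul_mem ho v
  exact ⟨t, hε.trans_le (h2 ε hm), h1, h2⟩

/-- A segment from an interior point to a point of a convex set meets the frontier only at its
endpoint. -/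
lemma add_smul_mem_interior {L : Set Plane} (hL : Convex ℝ L) {o v : Plane} (ho : o ∈ interior L)
    {s t : ℝ} (ht : 0 ≤ t) (hts : t < s) (hs : o + s • v ∈ L) : o + t • v ∈ interior L := by
  have hs0 : 0 < s := by linarith
  have := hL.combo_interior_self_mem_interior ho hs (a := 1 - t / s) (b := t / s)
    (by rw [sub_pos, div_lt_one hs0]; exact hts) (by positivity) (by ring)
  convert this using 1
  match_scalars <;> field_simp
  ring

lemma exists_support {L : Set Plane} (hL : Convex ℝ L) (hint : (interior L).Nonempty) {p : Plane}
    (hp : p ∉ interior L) :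
    ∃ f : Plane →L[ℝ] ℝ, (∃ e, 0 < f e) ∧ ∀ y ∈ L, f y ≤ f p := by
  obtain ⟨f, hf⟩ := geometric_hahn_banach_open_point hL.interior isOpen_interior hp
  obtain ⟨z, hz⟩ := hint
  refine ⟨f, ⟨p - z, by rw [map_sub, sub_pos]; exact hf z hz⟩, fun y hy => ?_⟩
  have hcl : y ∈ closure (interior L) := by
    rw [hL.closure_interior_eq_closure_of_nonempty_interior ⟨z, hz⟩]
    exact subset_closure hy
  exact closure_minimal (fun w hw => (hf w hw).le)
    (isClosed_le f.continuous continuous_const) hcl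

/-! ### Difference bodies -/

lemma zero_mem_interior_diffBody {K : Set Plane} (hint : (interior K).Nonempty) :
    (0 : Plane) ∈ interior (diffBody K) := by
  obtain ⟨z, hz⟩ := hint
  rw [mem_interior_iff_mem_nhds] at hz ⊢
  have hc : ContinuousAt (fun y : Plane => z + y) 0 := by fun_prop
  filter_upwards [hc (by simpa using hz)] with y hy
  exact ⟨z + y, hy, z, mem_of_mem_nhds hz, by simp⟩

lemma neg_mem_diffBody {K : Set Plane} {k : Plane} (hk : k ∈ diffBody K) : -k ∈ diffBody K := by
  obtain ⟨a, ha, b, hb, rfl⟩ := hk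
  exact ⟨b, hb, a, ha, by simp⟩

lemma neg_mem_frontier_diffBody {K : Set Plane} {k : Plane} (hk : k ∈ frontier (diffBody K)) :
    -k ∈ frontier (diffBody K) := by
  have h : diffBody K = -diffBody K := by
    ext y
    rw [Set.mem_neg]
    exact ⟨neg_mem_diffBody, fun h => by simpa using neg_mem_diffBody h⟩
  have h2 : -frontier (diffBody K) = frontier (-diffBody K) :=
    (Homeomorph.neg Plane).preimage_frontier _
  rw [h, ← h2]
  simpa using hk

lemma StrictBody.diffBody {K : Set Plane} (hK : StrictBody K) : StrictBody (diffBody K) where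
  compact := isCompact_diffBody hK.compact
  strict := hK.strict.sub hK.strict
  interior_nonempty := ⟨0, zero_mem_interior_diffBody hK.interior_nonempty⟩

lemma smul_notMem_of_mem_frontier {S : Set Plane} (hS : StrictBody S) (h0 : 0 ∈ interior S)
    {k : Plane} (hk : k ∈ frontier S) {r : ℝ} (hr : 1 < r) : r • k ∉ S := by
  intro h
  have := add_smul_mem_interior hS.convex h0 zero_le_one hr (by rwa [zero_add])
  rw [zero_add, one_smul] at this
  exact (hS.mem_frontier.1 hk).2 this

lemma eq_or_eq_neg_of_cross_eq_zero {K : Set Plane} (hK : StrictBody K) {k k' : Plane}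
    (hk : k ∈ frontier (diffBody K)) (hk' : k' ∈ frontier (diffBody K)) (h : cross k k' = 0) :
    k' = k ∨ k' = -k := by
  have h0 := zero_mem_interior_diffBody hK.interior_nonempty
  have hne : k ≠ 0 := by
    rintro rfl
    exact (hK.diffBody.mem_frontier.1 hk).2 h0
  obtain ⟨t, rfl⟩ := exists_smul_of_cross_eq_zero hne h
  have key : ∀ k ∈ frontier (diffBody K), ∀ t : ℝ, 0 < t → t • k ∈ frontier (diffBody K) →
      t = 1 := by
    intro k hk t ht htk
    rcases lt_trichotomy t 1 with h | h | h
    · exact absurd (hK.diffBody.mem_of_frontier hk) (by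
        have := smul_notMem_of_mem_frontier hK.diffBody h0 htk (r := t⁻¹)
          (by rw [one_lt_inv₀ ht]; exact h)
        rwa [smul_smul, inv_mul_cancel₀ ht.ne', one_smul] at this)
    · exact h
    · exact absurd (hK.diffBody.mem_of_frontier htk)
        (smul_notMem_of_mem_frontier hK.diffBody h0 hk h)
  rcases lt_trichotomy t 0 with ht | ht | ht
  · right
    have := key (-k) (neg_mem_frontier_diffBody hk) (-t) (by linarith) (by simpa using hk')
    have : t = -1 := by linarith
    rw [this]; simp
  · rw [ht, zero_smul] at hk'
    exact absurd h0 (hK.diffBody.mem_frontier.1 hk').2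
  · left
    rw [key k hk t ht hk', one_smul]

/-- Let `f` support `H` at a noninterior point of the open segment `xy`, and let `w` minimise `f` on
`H`. That point minus `w` maximises `f` on the difference body, but is a proper convex combination
of `x - w` and `y - w`, hence interior. -/
lemma strictConvex_of_diffBody {H : Set Plane} (hc : IsCompact H) (hv : Convex ℝ H)
    (hint : (interior H).Nonempty) (hD : StrictConvex ℝ (diffBody H)) : StrictConvex ℝ H := by
  intro x hx y hy hxy a b ha hb hab
  by_contra hz
  obtain ⟨f, ⟨e, he⟩, hf⟩ := exists_support hv hint hz
  obtain ⟨w, hw, hmin⟩ := hc.exists_isMinOn ⟨x, hx⟩ f.continuous.continuousOn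
  have h1 := hD (sub_mem_sub hx hw) (sub_mem_sub hy hw) (by simpa using hxy) ha hb hab
  obtain ⟨ε, hε, p, hp, q, hq, hpq⟩ := exists_pos_add_smul_mem h1 e
  have e1 : a • (x - w) + b • (y - w) = a • x + b • y - w := by
    have : a • (x - w) + b • (y - w) = a • x + b • y - (a + b) • w := by module
    rw [this, hab, one_smul]
  have e2 := congrArg f hpq
  simp only [e1, map_add, map_sub, map_smul, smul_eq_mul] at e2
  have h2 := hf p hp
  simp only [map_add, map_smul, smul_eq_mul] at h2
  have h3 : f w ≤ f q := hmin hq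
  have : 0 < ε * f e := by positivity
  linarith

/-! ### Centres of affine diameters -/

/-- `c` is the centre of a chord of `K` that is a translate of `[0, k]`. -/
def IsCenter (K : Set Plane) (k c : Plane) : Prop :=
  c + (1 / 2 : ℝ) • k ∈ K ∧ c - (1 / 2 : ℝ) • k ∈ K

lemma IsCenter.neg {K : Set Plane} {k c : Plane} (h : IsCenter K k c) : IsCenter K (-k) c := by
  constructor
  · convert h.2 using 1; module
  · convert h.1 using 1; module

lemma exists_isCenter {K : Set Plane} {k : Plane} (hk : k ∈ diffBody K) : ∃ c, IsCenter K k c := by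
  obtain ⟨a, ha, b, hb, rfl⟩ := hk
  refine ⟨(1 / 2 : ℝ) • (a + b), ?_, ?_⟩
  · convert ha using 1; beta_reduce; module
  · convert hb using 1; beta_reduce; module

/-- Averaging two different translates of the chord makes its end interior, so the chord could be
lengthened, putting `(1 + ε) k` in the difference body. -/
lemma IsCenter.unique {K : Set Plane} (hK : StrictBody K) {k c c' : Plane}
    (hk : k ∈ frontier (diffBody K)) (h : IsCenter K k c) (h' : IsCenter K k c') : c = c' := by
  by_contra hne
  have h1 := hK.strict h.1 h'.1 (by simpa using hne) (a := 1 / 2) (b := 1 / 2) (by norm_num)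
    (by norm_num) (by norm_num)
  obtain ⟨ε, hε, hm⟩ := exists_pos_add_smul_mem h1 k
  have h2 := hK.convex h.2 h'.2 (a := 1 / 2) (b := 1 / 2) (by norm_num) (by norm_num) (by norm_num)
  refine smul_notMem_of_mem_frontier hK.diffBody
    (zero_mem_interior_diffBody hK.interior_nonempty) hk (r := 1 + ε) (by linarith)
    ⟨_, hm, _, h2, ?_⟩
  beta_reduce
  module

lemma IsCenter.mem_frontier {K : Set Plane} (hK : StrictBody K) {k c : Plane}
    (hk : k ∈ frontier (diffBody K)) (h : IsCenter K k c) :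
    c + (1 / 2 : ℝ) • k ∈ frontier K := by
  refine hK.mem_frontier.2 ⟨h.1, fun hint => ?_⟩
  obtain ⟨ε, hε, hm⟩ := exists_pos_add_smul_mem hint k
  refine smul_notMem_of_mem_frontier hK.diffBody
    (zero_mem_interior_diffBody hK.interior_nonempty) hk (r := 1 + ε) (by linarith)
    ⟨_, hm, _, h.2, ?_⟩
  beta_reduce
  module

lemma IsCenter.mem_frontier' {K : Set Plane} (hK : StrictBody K) {k c : Plane}
    (hk : k ∈ frontier (diffBody K)) (h : IsCenter K k c) :
    c - (1 / 2 : ℝ) • k ∈ frontier K := by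
  convert h.neg.mem_frontier hK (neg_mem_frontier_diffBody hk) using 1
  module

/-- Chords with a common centre are the diagonals of an inscribed parallelogram with sides `(k -
k')/2` and `(k + k')/2`. Transfer it to `H` and take its diagonals. -/
lemma exists_common_center {K H : Set Plane} (hK : StrictBody K) (hH : StrictBody H)
    (hD : diffBody K = diffBody H) {k k' c : Plane} (hk : k ∈ frontier (diffBody K))
    (hk' : k' ∈ frontier (diffBody K)) (hpos : 0 < cross k k')
    (hg : ∀ᶠ y in 𝓝 ((1 / 2 : ℝ) • (k + k')), covariogram K y = covariogram H y)
    (hc : IsCenter K k c) (hc' : IsCenter K k' c) :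
    ∃ c', IsCenter H k c' ∧ IsCenter H k' c' := by
  have hne : k ≠ k' := by
    rintro rfl
    simp at hpos
  have hI : Inscribed K (c + (1 / 2 : ℝ) • k) ((1 / 2 : ℝ) • (k - k')) ((1 / 2 : ℝ) • (k + k')) := by
    refine ⟨?_, hc.mem_frontier hK hk, ?_, ?_, ?_⟩
    · simp only [cross_smul_left, cross_smul_right, cross_sub_left, cross_add_right, cross_self]
      rw [cross_swap k' k]; linarith
    · convert hc'.mem_frontier hK hk' using 1; module
    · convert hc'.mem_frontier' hK hk' using 1; module
    · convert hc.mem_frontier' hK hk using 1; module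
  have hint : (1 / 2 : ℝ) • (k + k') ∈ interior (diffBody K) := by
    rw [smul_add]
    exact hK.diffBody.strict (hK.diffBody.mem_of_frontier hk) (hK.diffBody.mem_of_frontier hk') hne
      (by norm_num) (by norm_num) (by norm_num)
  obtain ⟨p, hp⟩ := hI.transfer hK hH hint (hD ▸ hint) hg
  have m : ∀ {q}, q ∈ frontier H → q ∈ H := hH.mem_of_frontier
  refine ⟨p - (1 / 2 : ℝ) • k, ⟨?_, ?_⟩, ?_, ?_⟩
  · convert m hp.mem₁ using 1; module
  · convert m hp.mem₄ using 1; module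
  · convert m hp.mem₂ using 1; module
  · convert m hp.mem₃ using 1; module

lemma IsCenter.transfer {K H : Set Plane} (hK : StrictBody K) (hH : StrictBody H)
    (hD : diffBody K = diffBody H) {k k' c c' : Plane} (hk : k ∈ frontier (diffBody K))
    (hk' : k' ∈ frontier (diffBody K)) (hne : cross k k' ≠ 0)
    (hg : ∀ᶠ y in 𝓝 ((1 / 2 : ℝ) • (k + k')), covariogram K y = covariogram H y)
    (hc : IsCenter K k c) (hc' : IsCenter K k' c) (hcH : IsCenter H k c') : IsCenter H k' c' := by
  have key : ∃ c', IsCenter H k c' ∧ IsCenter H k' c' := by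
    rcases hne.lt_or_gt with h | h
    · obtain ⟨c', h1, h2⟩ := exists_common_center hK hH hD hk' hk (by rw [cross_swap]; linarith)
        (by rwa [add_comm]) hc' hc
      exact ⟨c', h2, h1⟩
    · exact exists_common_center hK hH hD hk hk' h hg hc hc'
  obtain ⟨c'', h1, h2⟩ := key
  rwa [hcH.unique hH (hD ▸ hk) h1]

/-- Locally constant centres are constant along connected sets of directions. -/
lemma isCenter_of_isPreconnected {H Γ : Set Plane} (hH : StrictBody H)
    (hΓ : Γ ⊆ frontier (diffBody H)) (hconn : IsPreconnected Γ)
    (hloc : ∀ k₀ ∈ Γ, ∀ᶠ k in 𝓝[Γ] k₀, ∀ c, IsCenter H k₀ c → IsCenter H k c)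
    {k k' c : Plane} (hk : k ∈ Γ) (hk' : k' ∈ Γ) (hc : IsCenter H k c) : IsCenter H k' c := by
  refine (hconn.induction₂ (fun k k' => ∀ c, IsCenter H k c ↔ IsCenter H k' c) ?_ ?_ ?_ hk hk'
    c).1 hc
  · intro k₀ hk₀
    filter_upwards [hloc k₀ hk₀, self_mem_nhdsWithin] with k h hk c
    refine ⟨h c, fun hc => ?_⟩
    obtain ⟨c₀, hc₀⟩ := exists_isCenter (hH.diffBody.mem_of_frontier (hΓ hk₀))
    rwa [hc.unique hH (hΓ hk) (h c₀ hc₀)]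
  · exact fun _ _ _ _ _ _ h1 h2 c => (h1 c).trans (h2 c)
  · exact fun _ _ _ _ h c => (h c).symm

/-! ### Centrally symmetric bodies -/

lemma isPreconnected_frontier {S : Set Plane} (hS : StrictBody S) : IsPreconnected (frontier S) := by
  obtain ⟨h, -, -, hfr⟩ := exists_homeomorph_image_interior_closure_frontier_eq_unitBall hS.convex
    hS.interior_nonempty hS.compact.isBounded
  have hsph : IsPreconnected (Metric.sphere (0 : Plane) 1) :=
    (isConnected_sphere (by simp [← Module.finrank_eq_rank]) 0 zero_le_one).isPreconnected
  rw [← hfr] at hsph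
  have := hsph.image h.symm h.symm.continuous.continuousOn
  rwa [← image_comp, h.symm_comp_self, image_id] at this

lemma exists_mem_frontier_of_isPreconnected {S U : Set Plane} (hS : IsPreconnected S)
    (hU : IsOpen U) {a b : Plane} (ha : a ∈ S) (haU : a ∈ U) (hb : b ∈ S) (hbU : b ∉ U) :
    ∃ x ∈ S, x ∈ frontier U := by
  by_contra! hno
  have hcov : S ⊆ U ∪ (closure U)ᶜ := by
    intro x hx
    by_cases hxU : x ∈ U
    · exact Or.inl hxU
    · refine Or.inr fun hcl => hno x hx ?_
      rw [hU.frontier_eq]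
      exact ⟨hcl, hxU⟩
  have := hS.subset_left_of_subset_union hU isClosed_closure.isOpen_compl
    (disjoint_compl_right_iff_subset.2 subset_closure) hcov ⟨a, ha, haU⟩
  exact hbU (this hb)

theorem exists_vadd_eq_of_symmetric {K H : Set Plane} (hK : StrictBody K) (hH : StrictBody H)
    (hsym : -K = K) (hD : diffBody K = diffBody H) {U : Set Plane} (hUo : IsOpen U)
    (hUD : U ⊆ diffBody K) (h0U : (0 : Plane) ∈ U) (hUfr : frontier U ⊆ interior (diffBody K))
    (hg : CovariogramCoincidence K H (frontier U)) : ∃ v : Plane, H = v +ᵥ K := by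
  have h0 := zero_mem_interior_diffBody hK.interior_nonempty
  have hhalf : ∀ k ∈ diffBody K, (1 / 2 : ℝ) • k ∈ K := by
    rintro k ⟨a, ha, b, hb, rfl⟩
    have hb' : -b ∈ K := by rw [← hsym]; simpa using hb
    convert hK.convex ha hb' (a := 1 / 2) (b := 1 / 2) (by norm_num) (by norm_num)
      (by norm_num) using 1
    beta_reduce; module
  have hcen : ∀ k ∈ frontier (diffBody K), IsCenter K k 0 := by
    intro k hk
    have hkD := hK.diffBody.mem_of_frontier hk
    refine ⟨by simpa using hhalf k hkD, ?_⟩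
    have := hhalf _ (neg_mem_diffBody hkD)
    rwa [zero_sub, ← smul_neg]
  have hloc : ∀ k₀ ∈ frontier (diffBody K), ∀ᶠ k in 𝓝[frontier (diffBody K)] k₀, ∀ c,
      IsCenter H k₀ c → IsCenter H k c := by
    intro k₀ hk₀
    have hfc : Continuous fun k' : Plane => (1 / 2 : ℝ) • (k₀ + k') := by fun_prop
    -- The midpoints `(k₀ + k')/2` form a connected set going from `0`, inside `U`, to `k₀`, outside
    -- `U`.
    obtain ⟨_, ⟨k', hk', rfl⟩, hfr⟩ := exists_mem_frontier_of_isPreconnected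
      ((isPreconnected_frontier hK.diffBody).image _ hfc.continuousOn) hUo
      (a := 0) (b := k₀) ⟨-k₀, neg_mem_frontier_diffBody hk₀, by simp⟩ h0U
      ⟨k₀, hk₀, by beta_reduce; rw [← two_smul ℝ k₀, smul_smul]; norm_num⟩
      (fun h => (hK.diffBody.mem_frontier.1 hk₀).2 (interior_maximal hUD hUo h))
    beta_reduce at hfr
    have hne : cross k₀ k' ≠ 0 := by
      intro hz
      rcases eq_or_eq_neg_of_cross_eq_zero hK hk₀ hk' hz with rfl | rfl
      · have h2 := hUfr hfr
        rw [← two_smul ℝ k', smul_smul] at h2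
        norm_num at h2
        exact (hK.diffBody.mem_frontier.1 hk₀).2 h2
      · rw [add_neg_cancel, smul_zero, hUo.frontier_eq] at hfr
        exact hfr.2 h0U
    have hgn : ∀ᶠ x in 𝓝 ((1 / 2 : ℝ) • (k₀ + k')), ∀ᶠ y in 𝓝 x,
        covariogram K y = covariogram H y :=
      (hg.filter_mono (nhds_le_nhdsSet hfr)).eventually_nhds
    have hev1 : ∀ᶠ k in 𝓝 k₀, ∀ᶠ y in 𝓝 ((1 / 2 : ℝ) • (k + k')),
        covariogram K y = covariogram H y := by
      have hfc2 : ContinuousAt (fun k : Plane => (1 / 2 : ℝ) • (k + k')) k₀ := by fun_prop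
      exact hfc2.eventually hgn
    have hev2 : ∀ᶠ k in 𝓝 k₀, cross k k' ≠ 0 := by
      have hfc2 : ContinuousAt (fun k : Plane => cross k k') k₀ := by fun_prop
      exact hfc2.eventually_ne hne
    filter_upwards [self_mem_nhdsWithin, hev1.filter_mono nhdsWithin_le_nhds,
      hev2.filter_mono nhdsWithin_le_nhds] with k hk hk1 hk2 c hc
    -- With `k'` fixed, the centre passes from `k₀` to `k'`, and from `k'` to every `k` near `k₀`.
    have h1 := IsCenter.transfer hK hH hD hk₀ hk' hne hgn.self_of_nhds (hcen _ hk₀) (hcen _ hk') hc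
    exact IsCenter.transfer hK hH hD hk' hk (by rw [cross_swap]; simpa using hk2)
      (by rwa [add_comm]) (hcen _ hk') (hcen _ hk) h1
  obtain ⟨k₁, hk₁⟩ : (frontier (diffBody K)).Nonempty := by
    obtain ⟨t, ht, -⟩ := exists_frontier_ray hK.diffBody.compact (interior_subset h0)
      (v := EuclideanSpace.single 0 1) (by simp)
    exact ⟨_, ht⟩
  obtain ⟨c, hc⟩ := exists_isCenter (hD ▸ hK.diffBody.mem_of_frontier hk₁ : k₁ ∈ diffBody H)
  have hall : ∀ k ∈ frontier (diffBody K), IsCenter H k c := by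
    intro k hk
    exact isCenter_of_isPreconnected hH (hD ▸ subset_rfl) (isPreconnected_frontier hK.diffBody)
      hloc hk₁ hk hc
  have hcH : c ∈ H := by
    convert hH.convex hc.1 hc.2 (a := 1 / 2) (b := 1 / 2) (by norm_num) (by norm_num)
      (by norm_num) using 1
    module
  refine ⟨c, Subset.antisymm (fun h hh => ?_) ?_⟩
  · rw [mem_vadd_set_iff_neg_vadd_mem, vadd_eq_add, neg_add_eq_sub]
    by_contra hn
    have hv : h - c ≠ 0 := by
      rintro h1
      rw [h1] at hn
      apply hn
      simpa using hhalf 0 (interior_subset h0)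
    obtain ⟨t, ht0, ht, htm⟩ := exists_frontier_ray_of_interior hK.diffBody.compact h0 hv
    rw [zero_add] at ht
    have ht2 : t < 2 := by
      by_contra! hle
      apply hn
      have hmem : (2 : ℝ) • (h - c) ∈ diffBody K := by
        have := hK.diffBody.convex (interior_subset h0) (hK.diffBody.mem_of_frontier ht)
          (a := 1 - 2 / t) (b := 2 / t) (by rw [sub_nonneg, div_le_one ht0]; exact hle)
          (by positivity) (by ring)
        rw [smul_zero, zero_add, smul_smul, div_mul_cancel₀ _ ht0.ne'] at this
        exact this
      have := hhalf _ hmem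
      rw [smul_smul] at this
      norm_num at this
      exact this
    -- Subtracting this chord endpoint from `h` gives `(1 + t/2) (h - c)`. As `t < 2`, it lies
    -- beyond the last point `t (h - c)` of the ray in the difference body.
    have h2 := (hall _ ht).2
    have h3 : (1 + t / 2) • (h - c) ∈ diffBody K := by
      rw [hD]
      refine ⟨h, hh, _, h2, ?_⟩
      beta_reduce; module
    have := htm (1 + t / 2) (by rwa [zero_add])
    linarith
  · rintro _ ⟨y, hy, rfl⟩
    change c + y ∈ H
    rcases eq_or_ne y 0 with rfl | hy0
    · simpa using hcH
    have hy2 : (2 : ℝ) • y ∈ diffBody K :=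
      ⟨y, hy, -y, by rw [← hsym]; simpa using hy, by beta_reduce; module⟩
    obtain ⟨t, ht0, ht, htm⟩ := exists_frontier_ray_of_interior hK.diffBody.compact h0 hy0
    rw [zero_add] at ht
    have ht2 : 2 ≤ t := htm 2 (by rwa [zero_add])
    have h2 := (hall _ ht).1
    have := hH.convex hcH h2 (a := 1 - 2 / t) (b := 2 / t)
      (by rw [sub_nonneg, div_le_one ht0]; exact ht2) (by positivity) (by ring)
    convert this using 1
    match_scalars <;> field_simp
    ring

/-! ### The covariogram determines the difference body -/

lemma convex_diffBody {K : Set Plane} (hv : Convex ℝ K) : Convex ℝ (diffBody K) := hv.sub hv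

lemma covariogram_pos_iff {K : Set Plane} (hK : IsCompact K) (hv : Convex ℝ K)
    (hint : (interior K).Nonempty) {x : Plane} :
    0 < covariogram K x ↔ x ∈ interior (diffBody K) := by
  have hmem : ∀ z, z ∈ x +ᵥ K ↔ z - x ∈ K := fun z => by
    rw [mem_vadd_set_iff_neg_vadd_mem, vadd_eq_add, neg_add_eq_sub]
  constructor
  · intro h
    have hconv : Convex ℝ (K ∩ (x +ᵥ K)) := hv.inter (hv.vadd x)
    have hne : (interior (K ∩ (x +ᵥ K))).Nonempty := by
      by_contra hempty
      rw [not_nonempty_iff_eq_empty] at hempty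
      have hz : volume (K ∩ (x +ᵥ K)) = 0 := by
        refine measure_mono_null (fun z hz => ?_) (hconv.addHaar_frontier volume)
        refine ⟨subset_closure hz, ?_⟩
        rw [hempty]; exact notMem_empty z
      simp [covariogram, hz] at h
    obtain ⟨z, hz⟩ := hne
    rw [mem_interior_iff_mem_nhds] at hz ⊢
    have hc : ContinuousAt (fun y : Plane => z - x + y) x := by fun_prop
    have he : z - x + x = z := sub_add_cancel z x
    rw [← he] at hz
    filter_upwards [hc hz] with y hy
    exact ⟨z - x + y, hy.1, z - x, (hmem z).1 (he ▸ mem_of_mem_nhds hz).2, by simp⟩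
  · intro hx
    obtain ⟨z, h1, h2⟩ := exists_interior_sub hv hint hx
    have hn : K ∩ (x +ᵥ K) ∈ 𝓝 z := by
      have hc : ContinuousAt (fun y : Plane => y - x) z := by fun_prop
      filter_upwards [mem_interior_iff_mem_nhds.1 h1, hc (mem_interior_iff_mem_nhds.1 h2)]
        with y hy1 hy2 using ⟨hy1, (hmem y).2 hy2⟩
    exact ENNReal.toReal_pos (Measure.measure_pos_of_mem_nhds _ hn).ne'
      ((measure_mono inter_subset_left).trans_lt hK.measure_lt_top).ne

lemma eq_of_frontier_subset {S T : Set Plane} (hS : IsCompact S) (hT : IsCompact T)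
    (hSv : Convex ℝ S) (hTv : Convex ℝ T) (h0S : (0 : Plane) ∈ interior S)
    (h0T : (0 : Plane) ∈ interior T) (h : frontier S ⊆ frontier T) : S = T := by
  refine Subset.antisymm (fun x hx => ?_) (fun x hx => ?_)
  · rcases eq_or_ne x 0 with rfl | hx0
    · exact interior_subset h0T
    obtain ⟨t, ht0, ht, hmax⟩ := exists_frontier_ray_of_interior hS h0S hx0
    rw [zero_add] at ht
    have ht1 : 1 ≤ t := hmax 1 (by simpa using hx)
    have := hTv (interior_subset h0T) (hT.isClosed.frontier_subset (h ht)) (a := 1 - 1 / t)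
      (b := 1 / t) (by rw [sub_nonneg, div_le_one ht0]; exact ht1) (by positivity) (by ring)
    rwa [smul_zero, zero_add, smul_smul, div_mul_cancel₀ _ ht0.ne', one_smul] at this
  · by_contra hn
    have hx0 : x ≠ 0 := by
      rintro rfl
      exact hn (interior_subset h0S)
    obtain ⟨t, ht0, ht, hmax⟩ := exists_frontier_ray_of_interior hS h0S hx0
    have ht1 : t < 1 := by
      by_contra! hle
      apply hn
      have := hSv (interior_subset h0S) (hS.isClosed.frontier_subset ht) (a := 1 - 1 / t)
        (b := 1 / t) (by rw [sub_nonneg, div_le_one ht0]; exact hle) (by positivity) (by ring)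
      rwa [smul_zero, zero_add, zero_add, smul_smul, div_mul_cancel₀ _ ht0.ne', one_smul] at this
    have := add_smul_mem_interior hTv h0T ht0.le ht1 (by simpa using hx)
    exact (h ht).2 this

/-- The covariogram is positive exactly on the interior of the difference body. So the two interiors
agree near the boundary of `DK`, which is therefore contained in that of `DH`. -/
lemma diffBody_eq_of_frontier {K H : Set Plane} (hK : IsCompact K) (hKv : Convex ℝ K)
    (hKi : (interior K).Nonempty) (hH : IsCompact H) (hHv : Convex ℝ H)
    (hHi : (interior H).Nonempty) (hg : CovariogramCoincidence K H (frontier (diffBody K))) :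
    diffBody K = diffBody H := by
  refine eq_of_frontier_subset (isCompact_diffBody hK) (isCompact_diffBody hH)
    (convex_diffBody hKv) (convex_diffBody hHv) (zero_mem_interior_diffBody hKi)
    (zero_mem_interior_diffBody hHi) fun x hx => ?_
  have hev : ∀ᶠ y in 𝓝 x, y ∈ interior (diffBody K) ↔ y ∈ interior (diffBody H) := by
    filter_upwards [hg.filter_mono (nhds_le_nhdsSet hx)] with y hy
    rw [← covariogram_pos_iff hK hKv hKi, ← covariogram_pos_iff hH hHv hHi, hy]
  refine ⟨closure_mono interior_subset ?_, fun h => hx.2 (hev.self_of_nhds.2 h)⟩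
  have hcl := hx.1
  rw [← (convex_diffBody hKv).closure_interior_eq_closure_of_nonempty_interior
    ⟨0, zero_mem_interior_diffBody hKi⟩, mem_closure_iff_frequently] at hcl
  exact mem_closure_iff_frequently.2 ((hcl.and_eventually hev).mono fun y hy => hy.2.1 hy.1)

/-- A functional separating `y` from `DH` would have a larger width on `K` than on `H`, but
`tendsto_covariogram_width` makes the widths equal. -/
lemma diffBody_subset_of_zero {K H : Set Plane} (hK : IsCompact K) (hKv : Convex ℝ K)
    (hKi : (interior K).Nonempty) (hH : IsCompact H) (hHv : Convex ℝ H)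
    (hHi : (interior H).Nonempty) (hg : ∀ᶠ x in 𝓝 (0 : Plane), covariogram K x = covariogram H x) :
    diffBody K ⊆ diffBody H := by
  intro y hy
  by_contra hn
  obtain ⟨f, u, hf, hu⟩ := geometric_hahn_banach_closed_point (convex_diffBody hHv)
    (isCompact_diffBody hH).isClosed hn
  obtain ⟨e, he⟩ := exists_cross_eq f
  have hu0 : 0 < u := by
    simpa using hf 0 (interior_subset (zero_mem_interior_diffBody hHi))
  have he0 : e ≠ 0 := by
    rintro rfl
    rw [he] at hu
    simp at hu
    linarith
  have hc : Continuous (cross e) := by fun_prop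
  have hKne : (cross e '' K).Nonempty := (hKi.mono interior_subset).image _
  have hHne : (cross e '' H).Nonempty := (hHi.mono interior_subset).image _
  obtain ⟨α, hα⟩ := (hK.image hc).exists_isLeast hKne
  obtain ⟨β, hβ⟩ := (hK.image hc).exists_isGreatest hKne
  obtain ⟨α', hα'⟩ := (hH.image hc).exists_isLeast hHne
  obtain ⟨β', hβ'⟩ := (hH.image hc).exists_isGreatest hHne
  have h1 := tendsto_covariogram_width he0 hK hKv hKi hα hβ
  have h2 := tendsto_covariogram_width he0 hH hHv hHi hα' hβ'
  have hev : ∀ᶠ n : ℕ in atTop, covariogram K ((1 / ((n : ℝ) + 1)) • e) =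
      covariogram H ((1 / ((n : ℝ) + 1)) • e) := by
    have ht : Tendsto (fun n : ℕ => (1 / ((n : ℝ) + 1)) • e) atTop (𝓝 ((0 : ℝ) • e)) :=
      tendsto_one_div_add_atTop_nhds_zero_nat.smul_const e
    rw [zero_smul] at ht
    exact ht.eventually hg
  have heq : β - α = β' - α' := by
    refine tendsto_nhds_unique h1 (h2.congr' ?_)
    filter_upwards [hev] with n hn
    rw [hn, hg.self_of_nhds]
  obtain ⟨a, ha, b, hb, rfl⟩ := hy
  obtain ⟨a', ha', haβ⟩ := hβ'.1
  obtain ⟨b', hb', hbα⟩ := hα'.1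
  have h3 := hf (a' - b') (sub_mem_sub ha' hb')
  have h4 := hβ.2 (mem_image_of_mem _ ha)
  have h5 := hα.2 (mem_image_of_mem _ hb)
  simp only [he, cross_sub_right] at h3 hu
  linarith

lemma diffBody_eq_of_zero {K H : Set Plane} (hK : IsCompact K) (hKv : Convex ℝ K)
    (hKi : (interior K).Nonempty) (hH : IsCompact H) (hHv : Convex ℝ H)
    (hHi : (interior H).Nonempty) (hg : CovariogramCoincidence K H {0}) :
    diffBody K = diffBody H := by
  rw [CovariogramCoincidence, nhdsSet_singleton] at hg
  exact (diffBody_subset_of_zero hK hKv hKi hH hHv hHi hg).antisymm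
    (diffBody_subset_of_zero hH hHv hHi hK hKv hKi (hg.mono fun _ h => h.symm))

/-! ### Transfer of locally constant centres -/

/-- Wherever the centre of the affine diameters of `K` is locally constant, so is that of `H`. -/
def CentersFollow (K H : Set Plane) : Prop :=
  ∀ k₀ ∈ frontier (diffBody K), ∀ᶠ k in 𝓝[frontier (diffBody K)] k₀, ∀ c, IsCenter K k₀ c →
    IsCenter K k c → ∀ c', IsCenter H k₀ c' → IsCenter H k c'

lemma centersFollow_of_frontier {K H : Set Plane} (hK : StrictBody K) (hH : StrictBody H)
    (hD : diffBody K = diffBody H)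
    (hg : CovariogramCoincidence K H (frontier (diffBody K))) : CentersFollow K H := by
  intro k₀ hk₀
  have hgn : ∀ᶠ x in 𝓝 k₀, ∀ᶠ y in 𝓝 x, covariogram K y = covariogram H y :=
    (hg.filter_mono (nhds_le_nhdsSet hk₀)).eventually_nhds
  have hc : Tendsto (fun k : Plane => (1 / 2 : ℝ) • (k₀ + k)) (𝓝 k₀) (𝓝 k₀) := by
    have h : Continuous fun k : Plane => (1 / 2 : ℝ) • (k₀ + k) := by fun_prop
    convert h.tendsto k₀ using 2
    module
  filter_upwards [self_mem_nhdsWithin, (hc.eventually hgn).filter_mono nhdsWithin_le_nhds]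
    with k hk hgk c h1 h2 c' h3
  by_cases hz : cross k₀ k = 0
  · rcases eq_or_eq_neg_of_cross_eq_zero hK hk₀ hk hz with rfl | rfl
    · exact h3
    · exact h3.neg
  · exact IsCenter.transfer hK hH hD hk₀ hk hz hgk h1 h2 h3

/-- The chord of `-k₀` is that of `k₀`, so the transfer applies to `-k₀` and `k`, whose midpoint is
near the origin when `k` is near `k₀`. -/
lemma centersFollow_of_zero {K H : Set Plane} (hK : StrictBody K) (hH : StrictBody H)
    (hD : diffBody K = diffBody H) (hg : CovariogramCoincidence K H {0}) : CentersFollow K H := by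
  intro k₀ hk₀
  rw [CovariogramCoincidence, nhdsSet_singleton] at hg
  have hc : Tendsto (fun k : Plane => (1 / 2 : ℝ) • (-k₀ + k)) (𝓝 k₀) (𝓝 0) := by
    have h : Continuous fun k : Plane => (1 / 2 : ℝ) • (-k₀ + k) := by fun_prop
    simpa using h.tendsto k₀
  filter_upwards [self_mem_nhdsWithin,
    (hc.eventually hg.eventually_nhds).filter_mono nhdsWithin_le_nhds]
    with k hk hgk c h1 h2 c' h3
  by_cases hz : cross k₀ k = 0
  · rcases eq_or_eq_neg_of_cross_eq_zero hK hk₀ hk hz with rfl | rfl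
    · exact h3
    · exact h3.neg
  · exact IsCenter.transfer hK hH hD (neg_mem_frontier_diffBody hk₀) hk
      (by rw [cross_neg_left]; simpa using hz) hgk h1.neg h2 h3.neg

/-! ### Caps and boundary arcs -/

lemma exists_strict_support {K : Set Plane} (hK : StrictBody K) {p : Plane} (hp : p ∈ frontier K) :
    ∃ e : Plane, (∀ y ∈ K, y ≠ p → cross e y < cross e p) ∧
      ∀ U ∈ 𝓝 p, ∃ ε > 0, ∀ y ∈ K, cross e p - ε ≤ cross e y → y ∈ U := by
  have hpK := hK.mem_frontier.1 hp
  obtain ⟨f, ⟨e', he'⟩, hf⟩ := exists_support hK.convex hK.interior_nonempty hpK.2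
  obtain ⟨e, he⟩ := exists_cross_eq f
  have hlt : ∀ y ∈ K, y ≠ p → cross e y < cross e p := by
    intro y hy hyp
    have hle := hf y hy
    simp only [he] at hle
    refine lt_of_le_of_ne hle fun heq => ?_
    obtain ⟨ε, hε, hm⟩ := exists_pos_add_smul_mem (hK.strict hy hpK.1 hyp (a := 1 / 2)
      (b := 1 / 2) (by norm_num) (by norm_num) (by norm_num)) e'
    have h1 := hf _ hm
    rw [he] at he'
    simp only [he, cross_add_right, cross_smul_right, heq] at h1
    have : 0 < ε * cross e e' := by positivity
    linarith
  refine ⟨e, hlt, fun U hU => ?_⟩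
  have hc : IsCompact (K \ interior U) := hK.compact.diff isOpen_interior
  rcases (K \ interior U).eq_empty_or_nonempty with h0 | hne
  · refine ⟨1, one_pos, fun y hy _ => interior_subset ?_⟩
    by_contra hn
    exact notMem_empty y (h0 ▸ ⟨hy, hn⟩)
  · obtain ⟨y₀, hy₀, hmax⟩ := hc.exists_isMaxOn hne
      (by fun_prop : Continuous fun y => cross e y).continuousOn
    have h1 := hlt y₀ hy₀.1 (by
      rintro rfl
      exact hy₀.2 (mem_interior_iff_mem_nhds.2 hU))
    refine ⟨(cross e p - cross e y₀) / 2, by linarith, fun y hy hle => interior_subset ?_⟩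
    by_contra hn
    have : cross e y ≤ cross e y₀ := hmax ⟨hy, hn⟩
    linarith

/-- Boundary points of a strictly convex body have arbitrarily small caps. -/
lemma exists_cap {K : Set Plane} (hK : StrictBody K) {p : Plane} (hp : p ∈ frontier K) {U : Set Plane}
    (hU : U ∈ 𝓝 p) : ∃ a ∈ frontier K, ∃ b ∈ frontier K, 0 < cross (b - a) (p - a) ∧
      ∀ y ∈ K, 0 ≤ cross (b - a) (y - a) → y ∈ U := by
  have hpK := hK.mem_frontier.1 hp
  obtain ⟨e, hlt, hcap⟩ := exists_strict_support hK hp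
  obtain ⟨ε, hε, hεU⟩ := hcap U hU
  obtain ⟨o, ho⟩ := hK.interior_nonempty
  have hop : cross e o < cross e p := hlt o (interior_subset ho) (by
    rintro rfl; exact hpK.2 ho)
  have he0 : e ≠ 0 := by
    rintro rfl
    simp at hop
  -- Level lines of `cross e` are parallel to `e`. The chord through `o'` in direction `e` thus cuts
  -- off a cap of height at most `ε` below the supporting line at `p`.
  set t := min 1 (ε / (cross e p - cross e o)) with ht
  have ht0 : 0 < t := lt_min one_pos (div_pos hε (by linarith))
  have hto : t * (cross e p - cross e o) ≤ ε := by
    rw [← le_div_iff₀ (by linarith)]; exact min_le_right _ _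
  have hint : t • o + (1 - t) • p ∈ interior K :=
    hK.convex.combo_interior_self_mem_interior ho hpK.1 ht0
      (sub_nonneg.2 (min_le_left _ _)) (by ring)
  set o' := t • o + (1 - t) • p with ho'
  have hfo : cross e o' = cross e p - t * (cross e p - cross e o) := by
    rw [ho', cross_add_right, cross_smul_right, cross_smul_right]; ring
  obtain ⟨t₂, ht₂, hb, -⟩ := exists_frontier_ray_of_interior hK.compact hint he0
  obtain ⟨t₁, ht₁, ha, -⟩ := exists_frontier_ray_of_interior hK.compact hint (neg_ne_zero.2 he0)
  have hcr : ∀ y, cross (o' + t₂ • e - (o' + t₁ • -e)) (y - (o' + t₁ • -e)) =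
      (t₁ + t₂) * (cross e y - cross e o') := by
    intro y
    have : o' + t₂ • e - (o' + t₁ • -e) = (t₁ + t₂) • e := by module
    rw [this, cross_smul_left, cross_sub_right, cross_add_right, cross_smul_right,
      cross_neg_right, cross_self]
    ring
  refine ⟨_, ha, _, hb, ?_, fun y hy h => hεU y hy ?_⟩
  · rw [hcr, hfo]
    have : 0 < t * (cross e p - cross e o) := mul_pos ht0 (by linarith)
    exact mul_pos (by linarith) (by linarith)
  · rw [hcr] at h
    have := nonneg_of_mul_nonneg_right h (by linarith)
    linarith

lemma midpoint_mem_interior {K : Set Plane} (hK : StrictBody K) {a b : Plane} (ha : a ∈ K)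
    (hb : b ∈ K) (hab : a ≠ b) : (1 / 2 : ℝ) • a + (1 / 2 : ℝ) • b ∈ interior K :=
  hK.strict ha hb hab (by norm_num) (by norm_num) (by norm_num)

lemma cross_midpoint (a b : Plane) :
    cross (b - a) ((1 / 2 : ℝ) • a + (1 / 2 : ℝ) • b - a) = 0 := by
  have : (1 / 2 : ℝ) • a + (1 / 2 : ℝ) • b - a = (1 / 2 : ℝ) • (b - a) := by module
  rw [this, cross_smul_right, cross_self, mul_zero]

lemma cross_ray_midpoint (a b y : Plane) (t : ℝ) :
    cross (b - a) ((1 / 2 : ℝ) • a + (1 / 2 : ℝ) • b +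
      t • (y - ((1 / 2 : ℝ) • a + (1 / 2 : ℝ) • b)) - a) = t * cross (b - a) (y - a) := by
  have h := cross_midpoint a b
  set μ := (1 / 2 : ℝ) • a + (1 / 2 : ℝ) • b
  have : μ + t • (y - μ) - a = t • (y - a) + (1 - t) • (μ - a) := by module
  rw [this, cross_add_right, cross_smul_right, cross_smul_right, h]
  ring

/-- If a set lies on the boundaries of two strictly convex bodies and is a neighbourhood of `p` in
the first boundary, then it contains a common open boundary cap of the two bodies around `p`. -/
lemma exists_common_cap {K L A : Set Plane} (hK : StrictBody K) (hL : StrictBody L)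
    (hAK : A ⊆ frontier K) (hAL : A ⊆ frontier L) {p : Plane} (hp : p ∈ arcRelInterior K A) :
    ∃ a ∈ A, ∃ b ∈ A, 0 < cross (b - a) (p - a) ∧
      ∀ y ∈ frontier L, 0 < cross (b - a) (y - a) → y ∈ A := by
  obtain ⟨U, hUo, hpU, hU⟩ := mem_nhdsWithin.1 hp.2
  obtain ⟨a, ha, b, hb, hpos, hcap⟩ := exists_cap hK (hAK hp.1) (hUo.mem_nhds hpU)
  have haA : a ∈ A := hU ⟨hcap a (hK.mem_of_frontier ha) (by simp), ha⟩
  have hbA : b ∈ A := hU ⟨hcap b (hK.mem_of_frontier hb) (by simp), hb⟩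
  have hab : a ≠ b := by
    rintro rfl
    simp at hpos
  have hμK := midpoint_mem_interior hK (hK.mem_of_frontier ha) (hK.mem_of_frontier hb) hab
  have hμL := midpoint_mem_interior hL (hL.mem_of_frontier (hAL haA))
    (hL.mem_of_frontier (hAL hbA)) hab
  refine ⟨a, haA, b, hbA, hpos, fun y hy hya => ?_⟩
  have hyμ := cross_midpoint a b
  have hray := cross_ray_midpoint a b y
  set μ := (1 / 2 : ℝ) • a + (1 / 2 : ℝ) • b with hμ
  have hv : y - μ ≠ 0 := by
    intro h0
    rw [← sub_eq_zero.1 h0] at hyμ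
    linarith
  -- The ray from `μ` through `y` leaves `K` at a point of `A`, hence of the boundary of `L`. Since
  -- `μ` is interior to `L`, the ray meets that boundary only once, so this point is `y`.
  obtain ⟨t, ht, htK, -⟩ := exists_frontier_ray_of_interior hK.compact hμK hv
  have hup : 0 < cross (b - a) (μ + t • (y - μ) - a) := by
    rw [hray]; positivity
  have hA : μ + t • (y - μ) ∈ A := hU ⟨hcap _ (hK.mem_of_frontier htK) hup.le, htK⟩
  have hy1 : μ + (1 : ℝ) • (y - μ) = y := by module
  have ht1 : t = 1 := by
    rcases lt_trichotomy t 1 with h | h | h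
    · exact absurd (add_smul_mem_interior hL.convex hμL ht.le h
        (by rw [hy1]; exact hL.mem_of_frontier hy)) (hL.mem_frontier.1 (hAL hA)).2
    · exact h
    · have := add_smul_mem_interior hL.convex hμL zero_le_one h
        (hL.mem_of_frontier (hAL hA))
      rw [hy1] at this
      exact absurd this (hL.mem_frontier.1 hy).2
  rwa [ht1, hy1] at hA

lemma mem_arcRelInterior_of_side {L A : Set Plane} {a d p : Plane} (hp : p ∈ A)
    (hpos : 0 < cross d (p - a)) (h : ∀ y ∈ frontier L, 0 < cross d (y - a) → y ∈ A) :
    p ∈ arcRelInterior L A := by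
  refine ⟨hp, mem_nhdsWithin.2 ⟨{y | 0 < cross d (y - a)}, ?_, hpos, fun y hy => h y hy.2 hy.1⟩⟩
  exact isOpen_lt continuous_const (by fun_prop)

lemma arcRelInterior_subset {K L A : Set Plane} (hK : StrictBody K) (hL : StrictBody L)
    (hAK : A ⊆ frontier K) (hAL : A ⊆ frontier L) : arcRelInterior K A ⊆ arcRelInterior L A := by
  intro p hp
  obtain ⟨a, -, b, -, hpos, h⟩ := exists_common_cap hK hL hAK hAL hp
  exact mem_arcRelInterior_of_side hp.1 hpos h

/-- Supporting lines at relatively interior points of a common boundary arc are common. -/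
lemma support_of_common_arc {K L A : Set Plane} (hK : StrictBody K) (hL : StrictBody L)
    (hAK : A ⊆ frontier K) (hAL : A ⊆ frontier L) {p : Plane} (hp : p ∈ arcRelInterior K A)
    {f : Plane →L[ℝ] ℝ} (hf : ∀ y ∈ K, f y ≤ f p) {y : Plane} (hy : y ∈ L) : f y ≤ f p := by
  obtain ⟨a, ha, b, hb, hpos, h⟩ := exists_common_cap hK hL hAK hAL hp
  by_contra! hlt
  have hab : a ≠ b := by
    rintro rfl
    simp at hpos
  have hμK := midpoint_mem_interior hK (hK.mem_of_frontier (hAK ha))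
    (hK.mem_of_frontier (hAK hb)) hab
  have hμL := midpoint_mem_interior hL (hL.mem_of_frontier (hAL ha))
    (hL.mem_of_frontier (hAL hb)) hab
  have hyμ := cross_midpoint a b
  have hray := cross_ray_midpoint a b
  set μ := (1 / 2 : ℝ) • a + (1 / 2 : ℝ) • b with hμ
  obtain ⟨t, ⟨ht, ht1⟩, ht0⟩ : ∃ t : ℝ, (0 < cross (b - a) (p + t • (y - p) - a) ∧ t < 1) ∧ 0 < t := by
    have hc : ContinuousAt (fun t : ℝ => cross (b - a) (p + t • (y - p) - a)) 0 :=
      (by fun_prop : Continuous fun t : ℝ => cross (b - a) (p + t • (y - p) - a)).continuousAt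
    have h1 : ∀ᶠ t in 𝓝 (0 : ℝ), 0 < cross (b - a) (p + t • (y - p) - a) :=
      hc.eventually_const_lt (by simpa using hpos)
    exact (((h1.and (eventually_lt_nhds one_pos)).filter_mono nhdsWithin_le_nhds).and
      (self_mem_nhdsWithin : Ioi (0 : ℝ) ∈ 𝓝[>] 0)).exists
  set z := p + t • (y - p) with hz
  have hzL : z ∈ L := by
    have := hL.convex (hL.mem_of_frontier (hAL hp.1)) hy (a := 1 - t) (b := t) (by linarith)
      ht0.le (by ring)
    convert this using 1
    rw [hz]; module
  have hfz : f p < f z := by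
    simp only [hz, map_add, map_smul, map_sub, smul_eq_mul]
    have : 0 < t * (f y - f p) := mul_pos ht0 (by linarith)
    linarith
  have hv : z - μ ≠ 0 := by
    intro h0
    rw [← sub_eq_zero.1 h0] at hyμ
    linarith
  -- The exit point of this ray from `L` is in `A`, hence in `K`. But `f` increases from `μ` through
  -- `z`, where it already exceeds `f p`.
  obtain ⟨s, -, hsL, hmax⟩ := exists_frontier_ray_of_interior hL.compact hμL hv
  have hs1 : 1 ≤ s := hmax 1 (by simpa using hzL)
  have hw := h _ hsL (by rw [hray]; positivity)
  have h1 := hf _ (hK.mem_of_frontier (hAK hw))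
  have h2 := hf _ (interior_subset hμK)
  rw [map_add, map_smul, map_sub, smul_eq_mul] at h1
  nlinarith

lemma eq_zero_or_one_of_mem_frontier {K : Set Plane} (hK : StrictBody K) {u w : Plane}
    (hu : u ∈ frontier K) (hw : w ∈ frontier K) (huw : u ≠ w) {t : ℝ}
    (ht : u + t • (w - u) ∈ frontier K) : t = 0 ∨ t = 1 := by
  have m : ∀ {q}, q ∈ frontier K → q ∈ K := hK.mem_of_frontier
  have hne : ∀ s r : ℝ, s ≠ r → u + s • (w - u) ≠ u + r • (w - u) := by
    intro s r hsr h
    have h0 : (s - r) • (w - u) = 0 := by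
      have : (s - r) • (w - u) = u + s • (w - u) - (u + r • (w - u)) := by module
      rw [this, h, sub_self]
    rcases smul_eq_zero.1 h0 with h1 | h1
    · exact hsr (by linarith)
    · exact huw (sub_eq_zero.1 h1).symm
  have e0 : u + (0 : ℝ) • (w - u) = u := by simp
  have e1 : u + (1 : ℝ) • (w - u) = w := by simp
  have key : ∀ s r q : ℝ, s < r → r < q → u + s • (w - u) ∈ frontier K →
      u + q • (w - u) ∈ frontier K → u + r • (w - u) ∉ frontier K := by
    intro s r q hsr hrq hs hq hr
    apply (hK.mem_frontier.1 hr).2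
    have h1 : 0 < q - s := by linarith
    have := hK.strict.add_smul_sub_mem (m hs) (m hq) (hne s q (by linarith))
      (t := (r - s) / (q - s)) (div_pos (by linarith) h1)
      (by rw [div_lt_one h1]; linarith)
    convert this using 1
    match_scalars <;> field_simp <;> ring
  by_contra! hcon
  rcases lt_or_gt_of_ne hcon.1 with h | h
  · exact key t 0 1 h one_pos ht (by rwa [e1]) (by rwa [e0])
  rcases lt_or_gt_of_ne hcon.2 with h' | h'
  · exact key 0 t 1 h h' (by rwa [e0]) (by rwa [e1]) ht
  · exact key 0 1 t one_pos h' (by rwa [e0]) ht (by rwa [e1])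

/-- A connected subset of the boundary containing `p` and `q` contains one of the two arcs with
endpoints `p`, `q`. -/
lemma contains_side {K A : Set Plane} (hK : StrictBody K) (hAK : A ⊆ frontier K)
    (hA : IsPreconnected A) {p q : Plane} (hp : p ∈ A) (hq : q ∈ A) (hpq : p ≠ q) :
    (∀ y ∈ frontier K, 0 < cross (q - p) (y - p) → y ∈ A) ∨
    (∀ y ∈ frontier K, 0 < cross (-(q - p)) (y - p) → y ∈ A) := by
  by_contra! hcon
  obtain ⟨⟨u, hu, hup, huA⟩, w, hw, hwp, hwA⟩ := hcon
  rw [cross_neg_left] at hwp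
  have huw : u ≠ w := by
    rintro rfl
    linarith
  have hzero : ∀ y ∈ A, cross (w - u) (y - u) ≠ 0 := by
    intro y hy h0
    obtain ⟨t, ht⟩ := exists_smul_of_cross_eq_zero (sub_ne_zero.2 huw.symm) h0
    have hyt : y = u + t • (w - u) := by rw [← ht]; abel
    rcases eq_zero_or_one_of_mem_frontier hK hu hw huw (t := t) (hyt ▸ hAK hy) with rfl | rfl
    · rw [zero_smul, add_zero] at hyt; exact huA (hyt ▸ hy)
    · rw [one_smul, add_sub_cancel] at hyt; exact hwA (hyt ▸ hy)
  -- The missing points `u`, `w` lie on opposite sides of the line `pq`; `c` is where their segment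
  -- crosses it. Being interior, `c` lies strictly between `p` and `q`, so these are separated by
  -- the line `uw`, which `A` avoids.
  set α := cross (q - p) (u - p) with hα
  set β := -cross (q - p) (w - p) with hβ
  have hc : u + (α / (α + β)) • (w - u) ∈ interior K :=
    hK.strict.add_smul_sub_mem (hK.mem_of_frontier hu) (hK.mem_of_frontier hw) huw (by positivity)
      (by rw [div_lt_one (by positivity)]; linarith)
  set c := u + (α / (α + β)) • (w - u) with hcdef
  have hcp : cross (q - p) (c - p) = 0 := by
    have : c - p = (u - p) + (α / (α + β)) • ((w - p) - (u - p)) := by rw [hcdef]; module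
    rw [this, cross_add_right, cross_smul_right, cross_sub_right _ (w - p) (u - p), ← hα]
    have : cross (q - p) (w - p) = -β := by rw [hβ, neg_neg]
    rw [this]
    field_simp
    ring
  obtain ⟨r, hr⟩ := exists_smul_of_cross_eq_zero (sub_ne_zero.2 hpq.symm) hcp
  have hcr : c = p + r • (q - p) := by rw [← hr]; abel
  have hr0 : 0 < r := by
    by_contra! hle
    apply (hK.mem_frontier.1 (hAK hp)).2
    have := hK.convex.combo_interior_self_mem_interior hc (hK.mem_of_frontier (hAK hq))
      (a := 1 / (1 - r)) (b := -r / (1 - r)) (div_pos one_pos (by linarith))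
      (div_nonneg (by linarith) (by linarith))
      (by have : (1 - r) ≠ 0 := by linarith
          field_simp; ring)
    convert this using 1
    have : (1 - r) ≠ 0 := by linarith
    rw [hcr]
    match_scalars <;> field_simp <;> ring
  have hr1 : r < 1 := by
    by_contra! hle
    apply (hK.mem_frontier.1 (hAK hq)).2
    have := hK.convex.combo_interior_self_mem_interior hc (hK.mem_of_frontier (hAK hp))
      (a := 1 / r) (b := (r - 1) / r) (by positivity)
      (div_nonneg (by linarith) (by linarith)) (by field_simp; ring)
    convert this using 1
    rw [hcr]
    match_scalars <;> field_simp <;> ring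
  have hfc : (1 - r) * cross (w - u) (p - u) + r * cross (w - u) (q - u) = 0 := by
    have h1 : cross (w - u) (c - u) = 0 := by
      rw [hcdef, add_sub_cancel_left, cross_smul_right, cross_self, mul_zero]
    have h2 : c - u = (1 - r) • (p - u) + r • (q - u) := by rw [hcr]; module
    rwa [h2, cross_add_right, cross_smul_right, cross_smul_right] at h1
  have hcont : ContinuousOn (fun y => cross (w - u) (y - u)) A :=
    (by fun_prop : Continuous fun y => cross (w - u) (y - u)).continuousOn
  have hfp := hzero p hp
  have hr1' : 0 < 1 - r := by linarith
  rcases lt_or_gt_of_ne hfp with h | h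
  · have h2 : 0 ≤ cross (w - u) (q - u) := by
      by_contra! hlt
      nlinarith [mul_neg_of_pos_of_neg hr0 hlt, mul_neg_of_pos_of_neg hr1' h]
    obtain ⟨y, hy, hy0⟩ := hA.intermediate_value hp hq hcont ⟨h.le, h2⟩
    exact hzero y hy hy0
  · have h2 : cross (w - u) (q - u) ≤ 0 := by
      by_contra! hlt
      nlinarith [mul_pos hr0 hlt, mul_pos hr1' h]
    obtain ⟨y, hy, hy0⟩ := hA.intermediate_value hq hp hcont ⟨h2, h.le⟩
    exact hzero y hy hy0

/-- A boundary arc with relatively interior points is the closure of its relative interior. -/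
lemma subset_closure_arcRelInterior {K A : Set Plane} (hK : StrictBody K) (hAK : A ⊆ frontier K)
    (hA : IsPreconnected A) (hne : (arcRelInterior K A).Nonempty) :
    A ⊆ closure (arcRelInterior K A) := by
  intro p hp
  obtain ⟨q, hq⟩ := hne
  rcases eq_or_ne p q with rfl | hpq
  · exact subset_closure hq
  obtain ⟨e, hlt, hcap⟩ := exists_strict_support hK (hAK hp)
  have hqp := hlt q (hK.mem_of_frontier (hAK hq.1)) hpq.symm
  have he0 : e ≠ 0 := by
    rintro rfl
    simp at hqp
  rw [mem_closure_iff_nhds]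
  intro U hU
  obtain ⟨ε, hε, hεU⟩ := hcap U hU
  have key : ∀ σ : ℝ, σ * σ = 1 → (∀ y ∈ frontier K, 0 < cross (σ • (q - p)) (y - p) → y ∈ A) →
      (U ∩ arcRelInterior K A).Nonempty := by
    intro σ hσ hside
    set t := min (1 / 2) (ε / (cross e p - cross e q)) with ht
    have ht0 : 0 < t := lt_min (by norm_num) (div_pos hε (by linarith))
    have hto : t * (cross e p - cross e q) ≤ ε := by
      rw [← le_div_iff₀ (by linarith)]; exact min_le_right _ _
    have hint := hK.strict.add_smul_sub_mem (hK.mem_of_frontier (hAK hp))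
      (hK.mem_of_frontier (hAK hq.1)) hpq ht0
      (lt_of_le_of_lt (min_le_left _ _) (by norm_num))
    have hσ0 : σ ≠ 0 := by rintro rfl; simp at hσ
    -- Starting on the chord `pq` near `p`, move parallel to the supporting line at `p` to the
    -- boundary. The level stays within `ε` of the maximum, and `σ` selects the side contained in
    -- `A`.
    obtain ⟨s, hs, hw, -⟩ := exists_frontier_ray_of_interior hK.compact hint
      (smul_ne_zero hσ0 he0)
    have hpos : 0 < cross (σ • (q - p)) (p + t • (q - p) + s • σ • e - p) := by
      have e1 : p + t • (q - p) + s • σ • e - p = t • (q - p) + (s * σ) • e := by module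
      rw [e1, cross_smul_left, cross_add_right, cross_smul_right, cross_smul_right, cross_self,
        cross_swap, cross_sub_right]
      have : σ * (t * 0 + s * σ * -(cross e q - cross e p)) =
          (σ * σ) * (s * (cross e p - cross e q)) := by ring
      rw [this, hσ, one_mul]
      exact mul_pos hs (by linarith)
    refine ⟨_, hεU _ (hK.mem_of_frontier hw) ?_,
      mem_arcRelInterior_of_side (hside _ hw hpos) hpos hside⟩
    simp only [cross_add_right, cross_smul_right, cross_sub_right, cross_self]
    linarith
  rcases contains_side hK hAK hA hp hq.1 hpq with h | h
  · exact key 1 (by norm_num) (by simpa using h)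
  · exact key (-1) (by norm_num) (by simpa using h)

/-! ### Homothetic copies -/

/-- The preimage of `K` under the homothety `y ↦ c + σ • y`. -/
def homothetic (K : Set Plane) (c : Plane) (σ : ℝ) : Set Plane := {y | c + σ • y ∈ K}

lemma exists_homeomorph_homothetic (c : Plane) {σ : ℝ} (hσ : σ ≠ 0) :
    ∃ φ : Plane ≃ₜ Plane, ∀ K, homothetic K c σ = φ ⁻¹' K :=
  ⟨(Homeomorph.smulOfNeZero σ hσ).trans (Homeomorph.addLeft c), fun _ => rfl⟩

lemma interior_homothetic (K : Set Plane) (c : Plane) {σ : ℝ} (hσ : σ ≠ 0) :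
    interior (homothetic K c σ) = homothetic (interior K) c σ := by
  obtain ⟨φ, hφ⟩ := exists_homeomorph_homothetic c hσ
  rw [hφ, hφ, φ.preimage_interior]

lemma frontier_homothetic (K : Set Plane) (c : Plane) {σ : ℝ} (hσ : σ ≠ 0) :
    frontier (homothetic K c σ) = homothetic (frontier K) c σ := by
  obtain ⟨φ, hφ⟩ := exists_homeomorph_homothetic c hσ
  rw [hφ, hφ, φ.preimage_frontier]

lemma StrictBody.homothetic {K : Set Plane} (hK : StrictBody K) (c : Plane) {σ : ℝ} (hσ : σ ≠ 0) :
    StrictBody (homothetic K c σ) where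
  compact := by
    obtain ⟨φ, hφ⟩ := exists_homeomorph_homothetic c hσ
    rw [hφ]
    exact φ.isCompact_preimage.2 hK.compact
  strict := by
    intro x hx y hy hxy a b ha hb hab
    rw [interior_homothetic _ _ hσ]
    have hne : c + σ • x ≠ c + σ • y := by
      intro h
      exact hxy (smul_right_injective Plane hσ (add_left_cancel h))
    have := hK.strict hx hy hne ha hb hab
    have he : a • (c + σ • x) + b • (c + σ • y) = (a + b) • c + σ • (a • x + b • y) := by module
    rw [he, hab, one_smul] at this
    exact this
  interior_nonempty := by
    obtain ⟨z, hz⟩ := hK.interior_nonempty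
    rw [interior_homothetic _ _ hσ]
    refine ⟨σ⁻¹ • (z - c), ?_⟩
    change c + σ • σ⁻¹ • (z - c) ∈ interior K
    rwa [smul_inv_smul₀ hσ, add_sub_cancel]

/-- Translating `H` back makes `A` a common boundary arc of two bodies, where
`arcRelInterior_subset` applies. -/
lemma vadd_mem_arcRelInterior {K H A : Set Plane} (hK : StrictBody K) (hH : StrictBody H)
    (hAK : A ⊆ frontier K) {v : Plane} (hAH : v +ᵥ A ⊆ frontier H) {p : Plane}
    (hp : p ∈ arcRelInterior K A) : v + p ∈ arcRelInterior H (v +ᵥ A) := by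
  have hsub : A ⊆ frontier (homothetic H v 1) := by
    rw [frontier_homothetic _ _ one_ne_zero]
    intro y hy
    change v + (1 : ℝ) • y ∈ frontier H
    rw [one_smul]
    exact hAH (vadd_mem_vadd_set hy)
  obtain ⟨hpA, hp2⟩ := arcRelInterior_subset hK (hH.homothetic v one_ne_zero) hAK hsub hp
  refine ⟨vadd_mem_vadd_set hpA, ?_⟩
  obtain ⟨u, huo, hpu, hu⟩ := mem_nhdsWithin.1 hp2
  refine mem_nhdsWithin.2 ⟨v +ᵥ u, huo.vadd v, vadd_mem_vadd_set hpu, ?_⟩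
  rintro _ ⟨⟨y, hy, rfl⟩, hyH⟩
  refine vadd_mem_vadd_set (hu ⟨hy, ?_⟩)
  rw [frontier_homothetic _ _ one_ne_zero]
  change v + (1 : ℝ) • y ∈ frontier H
  rwa [one_smul]

/-! ### Symmetric pairs of arcs -/

lemma two_smul_sub_mem_frontier {K A : Set Plane} {m : Plane} (hAK : A ⊆ frontier K)
    (hBK : Equiv.pointReflection m '' A ⊆ frontier K) {p : Plane} (hp : p ∈ A) :
    p ∈ frontier K ∧ (2 : ℝ) • m - p ∈ frontier K := by
  refine ⟨hAK hp, ?_⟩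
  have := hBK (mem_image_of_mem _ hp)
  rw [Equiv.pointReflection_apply, vsub_eq_sub, vadd_eq_add] at this
  convert this using 1
  module

/-- `K` and its reflection in `m` share the arc `A`, hence the supporting line at `p`; reflecting
back gives a parallel one at the opposite point. -/
lemma support_opposite {K A : Set Plane} (hK : StrictBody K) {m : Plane} (hAK : A ⊆ frontier K)
    (hBK : Equiv.pointReflection m '' A ⊆ frontier K) {p : Plane} (hp : p ∈ arcRelInterior K A)
    {f : Plane →L[ℝ] ℝ} (hf : ∀ y ∈ K, f y ≤ f p) {y : Plane} (hy : y ∈ K) :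
    f ((2 : ℝ) • m - p) ≤ f y := by
  have hσ : (-1 : ℝ) ≠ 0 := by norm_num
  have hsub : A ⊆ frontier (homothetic K ((2 : ℝ) • m) (-1)) := by
    rw [frontier_homothetic _ _ hσ]
    intro y hy
    have := (two_smul_sub_mem_frontier hAK hBK hy).2
    rwa [sub_eq_add_neg, ← neg_one_smul ℝ y] at this
  have h := support_of_common_arc hK (hK.homothetic ((2 : ℝ) • m) hσ) hAK hsub hp hf
    (y := (2 : ℝ) • m - y) (by
      change (2 : ℝ) • m + (-1 : ℝ) • ((2 : ℝ) • m - y) ∈ K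
      convert hy using 1; module)
  simp only [map_sub, map_smul, smul_eq_mul] at h ⊢
  linarith

/-- At relatively interior `p`, a functional maximal on `K` at `p` is minimal at `2m - p`, so it is
maximal on the difference body at `2(p - m)`. Other points of the arc follow by closure. -/
lemma double_mem_frontier_diffBody {K A : Set Plane} (hK : StrictBody K) {m : Plane}
    (hAK : A ⊆ frontier K) (hBK : Equiv.pointReflection m '' A ⊆ frontier K)
    (hA : IsPreconnected A) (hne : (arcRelInterior K A).Nonempty) {p : Plane} (hp : p ∈ A) :
    (2 : ℝ) • (p - m) ∈ frontier (diffBody K) := by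
  have hcl : IsClosed {p : Plane | (2 : ℝ) • (p - m) ∈ frontier (diffBody K)} :=
    isClosed_frontier.preimage (by fun_prop : Continuous fun p : Plane => (2 : ℝ) • (p - m))
  refine closure_minimal ?_ hcl (subset_closure_arcRelInterior hK hAK hA hne hp)
  intro p hp
  have hpm := two_smul_sub_mem_frontier hAK hBK hp.1
  obtain ⟨f, ⟨e, he⟩, hf⟩ := exists_support hK.convex hK.interior_nonempty
    (hK.mem_frontier.1 hpm.1).2
  refine hK.diffBody.mem_frontier.2
    ⟨⟨p, hK.mem_of_frontier hpm.1, _, hK.mem_of_frontier hpm.2, ?_⟩, fun hint => ?_⟩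
  · beta_reduce; module
  · obtain ⟨ε, hε, a, ha, b, hb, hab⟩ := exists_pos_add_smul_mem hint e
    have h1 := hf a ha
    have h2 := support_opposite hK hAK hBK hp hf hb
    have h3 := congrArg f hab
    simp only [map_add, map_sub, map_smul, smul_eq_mul] at h2 h3
    have : 0 < ε * f e := by positivity
    linarith

lemma isCenter_double {K A : Set Plane} (hK : StrictBody K) {m : Plane}
    (hAK : A ⊆ frontier K) (hBK : Equiv.pointReflection m '' A ⊆ frontier K) {p : Plane}
    (hp : p ∈ A) : IsCenter K ((2 : ℝ) • (p - m)) m := by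
  have h := two_smul_sub_mem_frontier hAK hBK hp
  constructor
  · convert hK.mem_of_frontier h.1 using 1; module
  · convert hK.mem_of_frontier h.2 using 1; module

/-- The centre of a symmetric pair of arcs is determined by any sub-arc of one of the arcs. -/
lemma center_eq_of_subset {K A A' : Set Plane} (hK : StrictBody K) {m m' : Plane}
    (hBK : Equiv.pointReflection m '' A ⊆ frontier K)
    (hAK' : A' ⊆ frontier K) (hBK' : Equiv.pointReflection m' '' A' ⊆ frontier K)
    (hsub : A ⊆ A') (hne : (arcRelInterior K A).Nonempty) : m = m' := by
  obtain ⟨p, hp⟩ := hne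
  have hAK := hsub.trans hAK'
  have hp' : p ∈ arcRelInterior K A' := ⟨hsub hp.1, mem_of_superset hp.2 hsub⟩
  obtain ⟨f, ⟨e, he⟩, hf⟩ := exists_support hK.convex hK.interior_nonempty
    (hK.mem_frontier.1 (hAK hp.1)).2
  by_contra hmm
  have h1 := hK.mem_of_frontier (two_smul_sub_mem_frontier hAK hBK hp.1).2
  have h2 := hK.mem_of_frontier (two_smul_sub_mem_frontier hAK' hBK' hp'.1).2
  have hne : (2 : ℝ) • m - p ≠ (2 : ℝ) • m' - p := by
    intro h
    exact hmm (smul_right_injective Plane two_ne_zero (sub_left_injective h))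
  -- Both reflected points minimise `f` on `K`; if distinct, their midpoint would be an interior
  -- minimiser.
  obtain ⟨ε, hε, hm⟩ := exists_pos_add_smul_mem (midpoint_mem_interior hK h1 h2 hne) (-e)
  have g1 := support_opposite hK hAK hBK hp hf hm
  have g2 := support_opposite hK hAK' hBK' hp' hf hm
  simp only [map_add, map_sub, map_smul, map_neg, smul_eq_mul] at g1 g2
  have : 0 < ε * f e := by positivity
  linarith

/-- The directions `2(p - m)`, `p ∈ A`, form a connected set on which the centre in `K` is `m`.
There the centre in `H` is a constant `c`, so the chord endpoints in `H` are those in `K` translated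
by `c - m`. -/
lemma IsSymmetricArcPair.exists_vadd {K H : Set Plane} (hK : StrictBody K) (hH : StrictBody H)
    (hD : diffBody K = diffBody H) (hfol : CentersFollow K H) {A B : Set Plane} {m : Plane}
    (hAB : IsSymmetricArcPair K A B) (hm : B = Equiv.pointReflection m '' A) :
    ∃ v : Plane, IsSymmetricArcPair H (v +ᵥ A) (v +ᵥ B) ∧
      v +ᵥ B = Equiv.pointReflection (v + m) '' (v +ᵥ A) ∧
      ∀ p ∈ A, IsCenter H ((2 : ℝ) • (p - m)) (v + m) := by
  have hAK := hAB.arc_left.1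
  have hBK : Equiv.pointReflection m '' A ⊆ frontier K := hm ▸ hAB.arc_right.1
  have hconn := hAB.arc_left.2.2
  have hfr : ∀ p ∈ A, (2 : ℝ) • (p - m) ∈ frontier (diffBody K) := fun p hp =>
    double_mem_frontier_diffBody hK hAK hBK hconn.isPreconnected hAB.nonempty_left hp
  obtain ⟨p₀, hp₀⟩ := hconn.nonempty
  obtain ⟨c, hc⟩ := exists_isCenter (hD ▸ hK.diffBody.mem_of_frontier (hfr p₀ hp₀) :
    (2 : ℝ) • (p₀ - m) ∈ diffBody H)
  set Γ := (fun p : Plane => (2 : ℝ) • (p - m)) '' A with hΓ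
  have hΓE : Γ ⊆ frontier (diffBody K) := by
    rintro _ ⟨p, hp, rfl⟩
    exact hfr p hp
  have hΓK : ∀ k ∈ Γ, IsCenter K k m := by
    rintro _ ⟨p, hp, rfl⟩
    exact isCenter_double hK hAK hBK hp
  have hcen : ∀ p ∈ A, IsCenter H ((2 : ℝ) • (p - m)) c := by
    intro p hp
    refine isCenter_of_isPreconnected hH (Γ := Γ) (hD ▸ hΓE)
      (hconn.isPreconnected.image _ (by fun_prop)) ?_ (mem_image_of_mem _ hp₀)
      (mem_image_of_mem _ hp) hc
    intro k₀ hk₀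
    filter_upwards [self_mem_nhdsWithin,
      (hfol k₀ (hΓE hk₀)).filter_mono (nhdsWithin_mono _ hΓE)] with k hk h c' hc'
    exact h m (hΓK _ hk₀) (hΓK _ hk) c' hc'
  have hvm : c - m + m = c := sub_add_cancel c m
  have hA : (c - m) +ᵥ A ⊆ frontier H := by
    rintro _ ⟨p, hp, rfl⟩
    convert (hcen p hp).mem_frontier hH (hD ▸ hfr p hp) using 1
    simp only [vadd_eq_add]; module
  have hB : (c - m) +ᵥ B ⊆ frontier H := by
    rintro _ ⟨q, hq, rfl⟩
    rw [hm] at hq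
    obtain ⟨p, hp, rfl⟩ := hq
    convert (hcen p hp).mem_frontier' hH (hD ▸ hfr p hp) using 1
    simp only [vadd_eq_add, Equiv.pointReflection_apply, vsub_eq_sub]; module
  have hrefl : (c - m) +ᵥ B = Equiv.pointReflection (c - m + m) '' ((c - m) +ᵥ A) := by
    rw [hm]
    ext y
    simp only [mem_vadd_set, mem_image, vadd_eq_add, Equiv.pointReflection_apply, vsub_eq_sub]
    constructor
    · rintro ⟨_, ⟨p, hp, rfl⟩, rfl⟩
      exact ⟨_, ⟨p, hp, rfl⟩, by module⟩
    · rintro ⟨_, ⟨p, hp, rfl⟩, rfl⟩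
      exact ⟨_, ⟨p, hp, rfl⟩, by module⟩
  have hback : ∀ S : Set Plane, S ⊆ frontier K → (c - m) +ᵥ S ⊆ frontier H →
      ∀ y ∈ arcRelInterior H ((c - m) +ᵥ S), -(c - m) + y ∈ arcRelInterior K S := by
    intro S hS hSH y hy
    have := vadd_mem_arcRelInterior hH hK hSH (v := -(c - m)) (by rwa [neg_vadd_vadd]) hy
    rwa [neg_vadd_vadd] at this
  have hconnv : ∀ S : Set Plane, IsConnected S → IsConnected ((c - m) +ᵥ S) := fun S hS =>
    hS.image _ (by fun_prop)
  refine ⟨c - m, ⟨⟨hA, hAB.arc_left.2.1.vadd _, hconnv _ hconn⟩,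
    ⟨hB, hAB.arc_right.2.1.vadd _, hconnv _ hAB.arc_right.2.2⟩, ⟨_, hrefl⟩, ?_, ?_, ?_⟩, hrefl,
    by rwa [hvm]⟩
  · obtain ⟨p, hp⟩ := hAB.nonempty_left
    exact ⟨_, vadd_mem_arcRelInterior hK hH hAK hA hp⟩
  · obtain ⟨p, hp⟩ := hAB.nonempty_right
    exact ⟨_, vadd_mem_arcRelInterior hK hH hAB.arc_right.1 hB hp⟩
  · rw [Set.disjoint_left]
    intro y hy1 hy2
    exact Set.disjoint_left.1 hAB.disjoint (hback A hAK hA y hy1)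
      (hback B hAB.arc_right.1 hB y hy2)

/-- A larger symmetric pair in `H` has the same centre and is carried back to a symmetric pair in
`K`. The translation back is the inverse one, so maximality in `K` applies. -/
lemma IsLocalSymmetry.exists_vadd {K H : Set Plane} (hK : StrictBody K) (hH : StrictBody H)
    (hD : diffBody K = diffBody H) (hKH : CentersFollow K H) (hHK : CentersFollow H K)
    {A B : Set Plane} (h : IsLocalSymmetry K A B) :
    ∃ v : Plane, IsLocalSymmetry H (v +ᵥ A) (v +ᵥ B) := by
  obtain ⟨m, hm⟩ := h.1.reflection
  obtain ⟨v, hv, hvm, hcen⟩ := h.1.exists_vadd hK hH hD hKH hm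
  refine ⟨v, hv, fun A' B' hAB' hA' hB' => ?_⟩
  obtain ⟨m', hm'⟩ := hAB'.reflection
  have hmm : v + m = m' := center_eq_of_subset hH (hvm ▸ hv.arc_right.1) hAB'.arc_left.1
    (hm' ▸ hAB'.arc_right.1) hA' hv.nonempty_left
  subst hmm
  obtain ⟨w, hw, -, hcen'⟩ := hAB'.exists_vadd hH hK hD.symm hHK hm'
  -- For `p ∈ A` the chord of `2(p - m)` in `K` has centre `m` and also `w + (v + m)`.
  have hwv : w = -v := by
    obtain ⟨p, hp⟩ := h.1.arc_left.2.2.nonempty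
    have hBK : Equiv.pointReflection m '' A ⊆ frontier K := hm ▸ h.1.arc_right.1
    have h1 := hcen' (v + p) (hA' (vadd_mem_vadd_set hp))
    rw [add_sub_add_left_eq_sub] at h1
    have h2 := isCenter_double hK h.1.arc_left.1 hBK hp
    have h3 := h1.unique hK (double_mem_frontier_diffBody hK h.1.arc_left.1 hBK
      h.1.arc_left.2.2.isPreconnected h.1.nonempty_left hp) h2
    rw [← add_assoc, add_eq_right] at h3
    exact eq_neg_of_add_eq_zero_left h3
  subst hwv
  have hsub : ∀ S S' : Set Plane, v +ᵥ S ⊆ S' → S ⊆ -v +ᵥ S' := by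
    intro S S' hS
    have := vadd_set_mono (a := -v) hS
    rwa [neg_vadd_vadd] at this
  obtain ⟨e1, e2⟩ := h.2 _ _ hw (hsub _ _ hA') (hsub _ _ hB')
  exact ⟨by rw [← e1, vadd_neg_vadd], by rw [← e2, vadd_neg_vadd]⟩

end PlanarCovariogram

theorem theorem1p3 (K H : ConvexBody PlanarCovariogram.Plane)
    (hK : (interior (K : Set PlanarCovariogram.Plane)).Nonempty)
    (hH : (interior (H : Set PlanarCovariogram.Plane)).Nonempty)
    (hKs : StrictConvex ℝ (K : Set PlanarCovariogram.Plane)) :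
    (-(K : Set PlanarCovariogram.Plane) = K →
      ∀ A : Set PlanarCovariogram.Plane,
        PlanarCovariogram.IsClosedSimpleCurve A →
        A ⊆ interior (PlanarCovariogram.diffBody K) →
        PlanarCovariogram.BoundsRegionAroundOrigin A (PlanarCovariogram.diffBody K) →
        PlanarCovariogram.diffBody K = PlanarCovariogram.diffBody H →
        PlanarCovariogram.CovariogramCoincidence K H A →
        PlanarCovariogram.CoincideUpToTranslationReflection K H) ∧
    (∀ X : Set PlanarCovariogram.Plane,
      (X = {0} ∨ X = frontier (PlanarCovariogram.diffBody K)) →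
      PlanarCovariogram.CovariogramCoincidence K H X →
      PlanarCovariogram.LocalSymmetriesCoincide K H) := by
  have hKb : PlanarCovariogram.StrictBody (K : Set PlanarCovariogram.Plane) :=
    ⟨K.isCompact, hKs, hK⟩
  have hHb : PlanarCovariogram.diffBody (K : Set PlanarCovariogram.Plane) =
      PlanarCovariogram.diffBody H →
      PlanarCovariogram.StrictBody (H : Set PlanarCovariogram.Plane) := fun hD =>
    ⟨H.isCompact, PlanarCovariogram.strictConvex_of_diffBody H.isCompact H.convex hH
      (hD ▸ hKb.diffBody.strict), hH⟩
  refine ⟨?_, ?_⟩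
  · rintro hsym _ - hA ⟨U, hUo, -, rfl, hUD, h0⟩ hD hg
    exact Or.inl (PlanarCovariogram.exists_vadd_eq_of_symmetric hKb (hHb hD) hsym hD hUo hUD h0
      hA hg)
  · intro X hX hg
    have hD : PlanarCovariogram.diffBody (K : Set PlanarCovariogram.Plane) =
        PlanarCovariogram.diffBody H := by
      rcases hX with rfl | rfl
      · exact PlanarCovariogram.diffBody_eq_of_zero K.isCompact K.convex hK H.isCompact H.convex
          hH hg
      · exact PlanarCovariogram.diffBody_eq_of_frontier K.isCompact K.convex hK H.isCompact
          H.convex hH hg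
    have hg' : PlanarCovariogram.CovariogramCoincidence H K X := hg.mono fun _ h => h.symm
    have hfol : PlanarCovariogram.CentersFollow (K : Set PlanarCovariogram.Plane) H ∧
        PlanarCovariogram.CentersFollow (H : Set PlanarCovariogram.Plane) K := by
      rcases hX with rfl | rfl
      · exact ⟨PlanarCovariogram.centersFollow_of_zero hKb (hHb hD) hD hg,
          PlanarCovariogram.centersFollow_of_zero (hHb hD) hKb hD.symm hg'⟩
      · refine ⟨PlanarCovariogram.centersFollow_of_frontier hKb (hHb hD) hD hg,
          PlanarCovariogram.centersFollow_of_frontier (hHb hD) hKb hD.symm ?_⟩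
        rwa [← hD]
    exact ⟨fun A B h => h.exists_vadd hKb (hHb hD) hD hfol.1 hfol.2,
      fun A B h => h.exists_vadd (hHb hD) hKb hD.symm hfol.2 hfol.1⟩
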